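/- Let $p\ge 2$, $m\ge 1$, $\sigma_0>0$, $\theta_1,\theta_2>1$, $L_p\ge 3$, $\kappa_{high}\ge 0$, $\kappa_p\in\mathbb{R}$. Let $n\ge1$ and let $f:\mathbb{R}^n\to\mathbb{R}$ satisfy: (1) $f$ is $p$ times continuously differentiable; (2) $f(x)\ge f_{\rm low}$ for all $x$; (3) $\|\nabla^p f(x)-\nabla^p f(y)\|\le L_p\|x-y\|$ for all $x,y$; (4) $\nabla^i f(x)[d]^i\ge-\kappa_{high}$ for all $x$, all $\|d\|\le 1$ and all $3\le i\le p-1$; (5) if $p\ge3$, $\|\nabla^p f(x)\|\le\kappa_p$ for all $x$. (Vectors carry the Euclidean norm and tensors the norm $\max_{\|v_i\|=1}|T[v_1,\dots,v_r]|$.) Algorithm ARpapprox-FD starts at $x_0$ with $\sigma_0$ and the convention $\|s_j\|=1$ for $j<0$. At iteration $k\ge 0$ it evaluates $\{\nabla^i f(x_k)\}_{i=1}^{p-1}$. If $m\mid k$ it sets $$h_k=\frac{\min\left(\sum_{i=1}^m\|s_{k-i}\|,\,1\right)}{\sqrt n},\qquad A_k=\sum_{i=1}^n\frac{\nabla^{p-1}f(x_k+h_ke_i)-\nabla^{p-1}f(x_k)}{h_k}\otimes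 e_i,\qquad T_k=P_{sym}(A_k),$$ where $P_{sym}$ averages a tensor over all permutations of its arguments; otherwise $T_k=T_{k-1}$. With $$\overline{T}_k(s)=f(x_k)+\sum_{i=1}^{p-1}\tfrac1{i!}\nabla^if(x_k)[s]^i+\tfrac1{p!}T_k[s]^p,\qquad m_k(s)=\overline{T}_k(s)+\tfrac{\sigma_k}{(p+1)!}\|s\|^{p+1},$$ it takes any step $s_k$ such that $$m_k(s_k)\le m_k(0),\qquad \|\nabla\overline{T}_k(s_k)\|\le\frac{\theta_1\sigma_k\|s_k\|^p}{p!},\qquad \max[0,-\lambda_{\min}(\nabla^2\overline{T}_k(s_k))]\le\frac{\theta_2\sigma_k\|s_k\|^{p-1}}{(p-1)!},$$ and sets $x_{k+1}=x_k+s_k$, $\sigma_{k+1}=\sigma_k+\sigma_k\|s_k\|^{p+1}$. It is understood that $h_k>0$ at every iteration $k$ with $m\mid k$ for which $x_k$ is not already an exact second-order critical point ($\nabla f(x_k)=0$, $\nabla^2 f(x_k)\succeq0$), so that the difference quotients make sense. Then there is a constant $C>0$, depending only on $p,m,\sigma_0,\theta_1,\theta_2,L_p,\kappa_{high},\kappa_p$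 and on upper bounds for $f(x_0)-f_{\rm low}$, $\|\nabla f(x_0)\|$ and $\max[0,-\lambda_{\min}(\nabla^2f(x_0))]$ (in particular not on $n$, $\epsilon_1$, $\epsilon_2$), such that for all $\epsilon_1,\epsilon_2\in(0,1]$, with $R=\max\left[\epsilon_1^{-(p+1)/p},\,\epsilon_2^{-(p+1)/(p-1)}\right]$, every run of at least $C R$ iterations produces, after some number $j\le C R$ of iterations, a point $x_\epsilon=x_j$ with $$\|\nabla f(x_\epsilon)\|\le\epsilon_1\quad\text{and}\quad\lambda_{\min}(\nabla^2 f(x_\epsilon))\ge-\epsilon_2,$$ and the number of points at which derivatives $\{\nabla^i f\}_{i=1}^{p-1}$ have been evaluated in iterations $0,\dots,j$ is at most $C\,n\,R$. -/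

import Mathlib

open scoped BigOperators Nat

namespace ARpFD

noncomputable section

/-- `ℝⁿ` with the Euclidean norm. -/
abbrev E (n : ℕ) : Type := EuclideanSpace ℝ (Fin n)

/-- The `i`-th vector of the canonical basis. -/
def e {n : ℕ} (i : Fin n) : E n := EuclideanSpace.single i 1

/-- Multilinear forms of order `r` on `ℝⁿ`; the norm is `max_{‖vᵢ‖ = 1} |T[v₁, …, v_r]|`. -/
abbrev Tensor (n r : ℕ) : Type := ContinuousMultilinearMap ℝ (fun _ : Fin r => E n) ℝ

/-! ### Tensors -/

/-- `M ⊗ eᵢ`, that is `(v₁, …, v_{q+1}) ↦ M[v₁, …, v_q] * ⟨eᵢ, v_{q+1}⟩`. -/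
def tensorBasis {n q : ℕ} (M : Tensor n q) (i : Fin n) : Tensor n (q + 1) :=
  ((ContinuousLinearMap.toSpanSingleton ℝ
      (EuclideanSpace.proj i : E n →L[ℝ] ℝ)).compContinuousMultilinearMap M).uncurryRight

theorem tensorBasis_apply {n q : ℕ} (M : Tensor n q) (i : Fin n) (v : Fin (q + 1) → E n) :
    tensorBasis M i v = M (fun j => v j.castSucc) * (v (Fin.last q)) i := by
  simp [tensorBasis, Fin.init_def]

/-- The projection `P_sym(T) = (1 / r!) ∑_τ τ(T)`, `τ(T)[v₁, …, v_r] = T[v_{τ 1}, …, v_{τ r}]`. -/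
def symmetrize {n r : ℕ} (T : Tensor n r) : Tensor n r :=
  (1 / (r ! : ℝ)) • ∑ τ : Equiv.Perm (Fin r), T.domDomCongr τ

/-! ### Curvature -/

/-- The Hessian matrix of `g` at `x`. -/
def hessian {n : ℕ} (g : E n → ℝ) (x : E n) : Matrix (Fin n) (Fin n) ℝ :=
  Matrix.of fun i j => iteratedFDeriv ℝ 2 g x ![e i, e j]

/-- The leftmost eigenvalue of a (symmetric) matrix. -/
def lambdaMin {n : ℕ} (A : Matrix (Fin n) (Fin n) ℝ) : ℝ := sInf (spectrum ℝ A)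

/-- `x` is an `(ε₁, ε₂)` second-order stationary point of `f`. -/
def SecondOrderStationary {n : ℕ} (f : E n → ℝ) (ε₁ ε₂ : ℝ) (x : E n) : Prop :=
  ‖gradient f x‖ ≤ ε₁ ∧ -ε₂ ≤ lambdaMin (hessian f x)

/-! ### Assumptions on the objective -/

/-- The assumptions on `f`: smoothness, lower bound, Lipschitz `p`-th derivative, one-sided bounds
on the derivatives of order `3, …, p - 1`, and (only if `p ≥ 3`) a bounded `p`-th derivative. -/
structure ProblemAssumptions {n : ℕ} (p : ℕ) (f : E n → ℝ) (flow L κhigh κp : ℝ) : Prop where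
  contDiff : ContDiff ℝ p f
  lower_bound : ∀ x, flow ≤ f x
  lipschitz : ∀ x y, ‖iteratedFDeriv ℝ p f x - iteratedFDeriv ℝ p f y‖ ≤ L * ‖x - y‖
  intermediate : ∀ i : ℕ, 3 ≤ i → i ≤ p - 1 → ∀ x d : E n, ‖d‖ ≤ 1 →
    -κhigh ≤ iteratedFDeriv ℝ i f x (fun _ => d)
  top_bounded : 3 ≤ p → ∀ x, ‖iteratedFDeriv ℝ p f x‖ ≤ κp

/-! ### Programs that call an oracle -/

/-- A computation that may query an oracle `Q → A` and returns a value in `α`. -/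
inductive OracleProg (Q A α : Type) : Type
  | ret (a : α) : OracleProg Q A α
  | query (q : Q) (next : A → OracleProg Q A α) : OracleProg Q A α

namespace OracleProg

variable {Q A α : Type}

/-- The value returned when the queries are answered by `O`. -/
def result (O : Q → A) : OracleProg Q A α → α
  | ret a => a
  | query q next => result O (next (O q))

/-- The number of queries made when they are answered by `O`. -/
def calls (O : Q → A) : OracleProg Q A α → ℕ
  | ret _ => 0
  | query q next => calls O (next (O q)) + 1

/-- Query the points `q 0, …, q (r - 1)` one after the other and continue with the answers. -/
def queryAll : (r : ℕ) → (Fin r → Q) → ((Fin r → A) → OracleProg Q A α) → OracleProg Q A α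
  | 0, _, cont => cont Fin.elim0
  | r + 1, q, cont =>
      query (q 0) fun a => queryAll r (fun i => q i.succ) fun v => cont (Fin.cons a v)

end OracleProg

/-! ### The algorithm -/

/-- An answer of the derivative oracle: one tensor of each order. -/
abbrev Jet (n : ℕ) : Type := (i : ℕ) → Tensor n i

/-- The derivative oracle: one call at `x` returns `∇ⁱf(x)` for `1 ≤ i ≤ p - 1`, and nothing about
the other orders. -/
def derivOracle {n : ℕ} (p : ℕ) (f : E n → ℝ) (x : E n) : Jet n := fun i =>
  if 1 ≤ i ∧ i ≤ p - 1 then iteratedFDeriv ℝ i f x else 0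

/-- The step lengths `‖s_j‖`, with `‖s_j‖ = 1` for negative `j`. -/
def stepNorm {n : ℕ} (s : ℕ → E n) (j : ℤ) : ℝ := if 0 ≤ j then ‖s j.toNat‖ else 1

/-- The discretization step `h_k = min(∑_{i=1}^m ‖s_{k-i}‖, 1) / √n`. -/
def fdStep {n : ℕ} (m : ℕ) (s : ℕ → E n) (k : ℕ) : ℝ :=
  min (∑ i ∈ Finset.Icc 1 m, stepNorm s ((k : ℤ) - (i : ℤ))) 1 / Real.sqrt n

/-- The finite-difference tensor `∑ᵢ ((∇^{p-1}f(x + h eᵢ) - ∇^{p-1}f(x)) / h) ⊗ eᵢ`, from the oracle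
answers `J` at `x` and `D i` at `x + h eᵢ`. (Order `p = 0` is irrelevant.) -/
def fdTensor {n : ℕ} (h : ℝ) (J : Jet n) (D : Fin n → Jet n) : (p : ℕ) → Tensor n p
  | 0 => 0
  | q + 1 => ∑ i, tensorBasis (h⁻¹ • (D i q - J q)) i

/-- The derivative evaluations of iteration `k`, at the point `x` and with discretization step `h`:
the derivatives at `x` are computed and, if `m ∣ k`, the tensor is refreshed by symmetrized finite
differences; otherwise the previous tensor `Tprev` is kept. Returns the derivatives at `x` and the
new tensor. -/
def iteration {n : ℕ} (p m k : ℕ) (x : E n) (h : ℝ) (Tprev : Tensor n p) :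
    OracleProg (E n) (Jet n) (Jet n × Tensor n p) :=
  .query x fun J =>
    if k % m = 0 then
      OracleProg.queryAll n (fun i => x + h • e i) fun D =>
        .ret (J, symmetrize (fdTensor h J D p))
    else .ret (J, Tprev)

/-- The inexact Taylor polynomial `f₀ + ∑_{i=1}^{p-1} (1/i!) J_i[s]^i + (1/p!) T[s]^p`. -/
def approxTaylor {n p : ℕ} (f₀ : ℝ) (J : Jet n) (T : Tensor n p) (s : E n) : ℝ :=
  f₀ + ∑ i ∈ Finset.Icc 1 (p - 1), (1 / (i ! : ℝ)) * J i (fun _ => s)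
    + (1 / (p ! : ℝ)) * T (fun _ => s)

/-- The regularized model. -/
def model {n p : ℕ} (f₀ : ℝ) (J : Jet n) (T : Tensor n p) (σ : ℝ) (s : E n) : ℝ :=
  approxTaylor f₀ J T s + σ / ((p + 1)! : ℝ) * ‖s‖ ^ (p + 1)

/-- The three tests on the step `s`. They do not depend on the value of the constant `f₀`. -/
structure StepAccepted {n p : ℕ} (θ₁ θ₂ f₀ : ℝ) (J : Jet n) (T : Tensor n p) (σ : ℝ) (s : E n) :
    Prop where
  decrease : model f₀ J T σ s - model f₀ J T σ 0 ≤ 0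
  gradient_small : ‖gradient (approxTaylor f₀ J T) s‖ ≤ θ₁ * σ * ‖s‖ ^ p / (p ! : ℝ)
  curvature_small : max 0 (-lambdaMin (hessian (approxTaylor f₀ J T) s))
    ≤ θ₂ * σ * ‖s‖ ^ (p - 1) / ((p - 1)! : ℝ)

/-- The program executed in iteration `k` of a run with iterates `x`, steps `s`, tensors `T`. (For
`k = 0` the tensor is refreshed, so that the value used for the previous tensor is irrelevant.) -/
def runIteration {n p : ℕ} (m : ℕ) (x s : ℕ → E n) (T : ℕ → Tensor n p) (k : ℕ) :
    OracleProg (E n) (Jet n) (Jet n × Tensor n p) :=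
  iteration p m k (x k) (fdStep m s k) (T (k - 1))

/-- The sequences `x, s, σ, T` are produced by the first `N` iterations of the finite-difference
algorithm started at `x₀` with regularization parameter `σ₀`.

The difference quotients of a refresh make sense only for `h_k > 0`; this is required unless `x_k`
is already an exact second-order critical point (in which case the tensor does not matter). -/
structure IsRun {n p : ℕ} (m : ℕ) (σ₀ θ₁ θ₂ : ℝ) (f : E n → ℝ) (x₀ : E n) (N : ℕ)
    (x s : ℕ → E n) (σ : ℕ → ℝ) (T : ℕ → Tensor n p) : Prop where
  x_zero : x 0 = x₀
  σ_zero : σ 0 = σ₀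
  fdStep_pos : ∀ k < N, k % m = 0 → 0 < fdStep m s k ∨ SecondOrderStationary f 0 0 (x k)
  tensor : ∀ k < N, T k = ((runIteration m x s T k).result (derivOracle p f)).2
  step : ∀ k < N, StepAccepted θ₁ θ₂ (f (x k))
    ((runIteration m x s T k).result (derivOracle p f)).1 (T k) (σ k) (s k)
  x_succ : ∀ k < N, x (k + 1) = x k + s k
  σ_succ : ∀ k < N, σ (k + 1) = σ k + σ k * ‖s k‖ ^ (p + 1)

/-- The number of evaluations of `{∇ⁱf}_{i=1}^{p-1}` made in the iterations `0, …, N - 1`. -/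
def evaluations {n p : ℕ} (m : ℕ) (f : E n → ℝ) (x s : ℕ → E n) (T : ℕ → Tensor n p) (N : ℕ) : ℕ :=
  ∑ k ∈ Finset.range N, (runIteration m x s T k).calls (derivOracle p f)

/-- `max[ε₁^{-(p+1)/p}, ε₂^{-(p+1)/(p-1)}]`. -/
def rate (p : ℕ) (ε₁ ε₂ : ℝ) : ℝ :=
  max (ε₁ ^ (-((p : ℝ) + 1) / (p : ℝ))) (ε₂ ^ (-((p : ℝ) + 1) / ((p : ℝ) - 1)))

end

end ARpFD

/-! The inexact Taylor polynomial matches the derivatives of `f` at `x_k` below order `p`, so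
repeated mean value inequalities bound the error in its derivative of order `p - j` at `s_k` by
`(L‖s_k‖ + ‖T_k - ∇^p f(x_k)‖) ‖s_k‖^j` (`norm_iteratedFDeriv_sub_approxTaylor_le`). A fresh tensor
has error at most `L √n h_k`, which the choice of `h_k` bounds by `L` times the sum of the last `m`
step lengths. Keeping it for one more iteration costs `L‖s_k‖`. Hence the whole error is at most `L
W_k ‖s_k‖^j`, where `W_k` is the `window` of recent step lengths and does not involve `n`.

This gives `IsRun.step_bounds`: after step `k` the gradient is `O(W_k^p)`, the negative curvature is
`O(W_k^(p-1))`, and the increment `σ_k ‖s_k‖^(p+1)` of `σ` is controlled by the decrease of `f` plus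
`L W_k^(p+1)`.

Summation gives `σ_K - σ_0 ≤ C₁ + C₂ ∑ ‖s_k‖^(p+1)`. Once `σ_k > 2 C₂`, half of the increment of `σ`
pays for the term `C₂ ‖s_k‖^(p+1)`. Before that, the earlier steps are paid for by the growth of `σ`
up to `2 C₂`, and the last step below the threshold is bounded through the one-sided derivative
bounds (`IsRun.norm_step_le`). So `σ` is bounded (`update_bounded`, `exists_σ_bound`), and therefore
`∑ ‖s_k‖^(p+1)` and `∑ W_k^(p+1)` are bounded too. Every non-stationary `x_{k+1}` forces `W_k^(p+1)`
to be at least a constant over `R`, so there are `O(R)` of them (`IsRun.length_le`), and each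
iteration makes at most `n + 1` evaluations. -/

namespace ARpFD

/-! ### Symmetry of higher derivatives, Taylor remainders and homogeneous polynomials. -/

section Calculus

variable {V F : Type*} [NormedAddCommGroup V] [NormedSpace ℝ V]
  [NormedAddCommGroup F] [NormedSpace ℝ F]

/-- Derivatives of order `k` evaluated at a fixed tuple can be differentiated termwise. -/
theorem fderiv_iteratedFDeriv_apply_const {f : V → F} {k : ℕ} (hf : ContDiff ℝ (k + 1 : ℕ) f)
    (x u : V) (w : Fin k → V) :
    fderiv ℝ (fun y => iteratedFDeriv ℝ k f y w) x u = fderiv ℝ (iteratedFDeriv ℝ k f) x u w := by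
  have hd : DifferentiableAt ℝ (iteratedFDeriv ℝ k f) x :=
    (hf.differentiable_iteratedFDeriv (by exact_mod_cast Nat.lt_succ_self k)) x
  have := ((ContinuousMultilinearMap.apply ℝ (fun _ : Fin k => V) F w).hasFDerivAt.comp x
    hd.hasFDerivAt).fderiv
  have h2 := congrArg (fun A => A u) this
  simpa [Function.comp_def] using h2

theorem fderiv_clm_comp_apply {W : Type*} [NormedAddCommGroup W] [NormedSpace ℝ W]
    (A : W →L[ℝ] F) {H : V → V →L[ℝ] W} {x : V} (hH : DifferentiableAt ℝ H x) (u w : V) :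
    fderiv ℝ (fun y => A (H y w)) x u = A (fderiv ℝ H x u w) := by
  let ev : (V →L[ℝ] W) →L[ℝ] F := A.comp (ContinuousLinearMap.apply ℝ W w)
  have h1 := ev.hasFDerivAt.comp x hH.hasFDerivAt
  have h2 := congrArg (fun A => A u) h1.fderiv
  simpa [ev, Function.comp_def] using h2

/-- Swapping the first two slots is the symmetry of the second derivative of `iteratedFDeriv ℝ k f`.
A swap further right leaves the leading slot alone and follows by differentiating the induction
hypothesis. -/
theorem iteratedFDeriv_comp_swap {f : V → F} :
    ∀ {k : ℕ}, ContDiff ℝ (k + 1 : ℕ) f → ∀ (x : V) (i : Fin k) (v : Fin (k + 1) → V),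
      iteratedFDeriv ℝ (k + 1) f x (v ∘ Equiv.swap i.castSucc i.succ)
        = iteratedFDeriv ℝ (k + 1) f x v := by
  intro k
  induction k with
  | zero => intro _ _ i; exact i.elim0
  | succ k ih =>
    intro hf x i v
    have hf' : ContDiff ℝ (k + 1 : ℕ) f := hf.of_le (by exact_mod_cast Nat.le_succ _)
    induction i using Fin.cases with
    | zero =>
      have key : ∀ w : Fin (k + 2) → V, iteratedFDeriv ℝ (k + 2) f x w =
          fderiv ℝ (fderiv ℝ (iteratedFDeriv ℝ k f)) x (w 0) (w 1) (fun i => w i.succ.succ) := by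
        intro w
        rw [iteratedFDeriv_succ_apply_left, ← fderiv_iteratedFDeriv_apply_const hf]
        have hg : ContDiff ℝ 2 (iteratedFDeriv ℝ k f) :=
          hf.iteratedFDeriv_right (by norm_cast; omega)
        have hd : DifferentiableAt ℝ (fderiv ℝ (iteratedFDeriv ℝ k f)) x :=
          ((hg.fderiv_right (m := 1) (by norm_num)).differentiable (by norm_num)) x
        have h2 := fderiv_clm_comp_apply (ContinuousMultilinearMap.apply ℝ (fun _ : Fin k => V) F
          fun i => w i.succ.succ) hd (w 0) (w 1)
        simp only [iteratedFDeriv_succ_apply_left]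
        simpa [Fin.tail_def] using h2
      have hsymm : IsSymmSndFDerivAt ℝ (iteratedFDeriv ℝ k f) x := by
        have hg : ContDiff ℝ 2 (iteratedFDeriv ℝ k f) :=
          hf.iteratedFDeriv_right (by norm_cast; omega)
        exact hg.contDiffAt.isSymmSndFDerivAt (by simp)
      rw [key, key]
      have e0 : (v ∘ Equiv.swap (Fin.castSucc (0 : Fin (k + 1))) (Fin.succ 0)) 0 = v 1 := by simp
      have e1 : (v ∘ Equiv.swap (Fin.castSucc (0 : Fin (k + 1))) (Fin.succ 0)) 1 = v 0 := by simp
      have e2 : (fun i : Fin k => (v ∘ Equiv.swap (Fin.castSucc (0 : Fin (k + 1))) (Fin.succ 0))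
          i.succ.succ) = fun i => v i.succ.succ := by
        funext i
        simp only [Function.comp_apply]
        rw [Equiv.swap_apply_of_ne_of_ne]
        · simp
        · exact fun h => Fin.succ_ne_zero _ (Fin.succ_injective _ h)
      rw [e0, e1, e2, hsymm.eq]
    | succ j =>
      have htail : Fin.tail (v ∘ Equiv.swap j.succ.castSucc j.succ.succ)
          = Fin.tail v ∘ Equiv.swap j.castSucc j.succ := by
        funext i
        simp only [Fin.tail_def, Function.comp_apply]
        congr 1
        rw [Fin.castSucc_succ]
        exact ((Fin.succ_injective _).swap_apply _ _ _)
      rw [iteratedFDeriv_succ_apply_left, iteratedFDeriv_succ_apply_left,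
        ← fderiv_iteratedFDeriv_apply_const hf, ← fderiv_iteratedFDeriv_apply_const hf, htail]
      have h0 : (v ∘ Equiv.swap j.succ.castSucc j.succ.succ) 0 = v 0 := by
        simp only [Function.comp_apply]
        rw [Equiv.swap_apply_of_ne_of_ne]
        · simp [Fin.ext_iff]
        · simp [Fin.ext_iff]
      rw [h0]
      congr 2
      funext y
      exact ih hf' y j _

/-- The `k`-th derivative of a `C^k` function is symmetric. -/
theorem iteratedFDeriv_comp_perm {f : V → F} {k : ℕ} (hf : ContDiff ℝ k f) (x : V)
    (τ : Equiv.Perm (Fin k)) (v : Fin k → V) :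
    iteratedFDeriv ℝ k f x (v ∘ τ) = iteratedFDeriv ℝ k f x v := by
  cases k with
  | zero => congr 1; exact Subsingleton.elim _ _
  | succ k =>
    -- Adjacent transpositions generate the symmetric group.
    have hτ : τ ∈ Submonoid.closure
        (Set.range fun i : Fin k => Equiv.swap i.castSucc i.succ) := by
      rw [Equiv.Perm.mclosure_swap_castSucc_succ]; trivial
    induction hτ using Submonoid.closure_induction generalizing v with
    | mem τ h => obtain ⟨i, rfl⟩ := h; exact iteratedFDeriv_comp_swap hf x i v
    | one => rfl
    | mul a b _ _ iha ihb =>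
      rw [Equiv.Perm.coe_mul, ← Function.comp_assoc, ihb, iha]

/-- If the derivatives of order `< p` vanish at `0` and that of order `p` is bounded by `M` on a
ball, then all lower derivatives are bounded there. -/
theorem norm_iteratedFDeriv_le_of_vanish {g : V → F} {p : ℕ} (hg : ContDiff ℝ p g)
    (h0 : ∀ i < p, iteratedFDeriv ℝ i g 0 = 0) {M r : ℝ} (hr : 0 ≤ r)
    (hM : ∀ y, ‖y‖ ≤ r → ‖iteratedFDeriv ℝ p g y‖ ≤ M) :
    ∀ j ≤ p, ∀ y, ‖y‖ ≤ r → ‖iteratedFDeriv ℝ (p - j) g y‖ ≤ M * r ^ j := by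
  have hM0 : 0 ≤ M := (norm_nonneg _).trans (hM 0 (by simpa using hr))
  intro j
  induction j with
  | zero => intro _ y hy; simpa using hM y hy
  | succ j ih =>
    intro hj y hy
    have hlt : p - (j + 1) < p := by omega
    have hd : Differentiable ℝ (iteratedFDeriv ℝ (p - (j + 1)) g) :=
      hg.differentiable_iteratedFDeriv (by exact_mod_cast hlt)
    have hsucc : p - (j + 1) + 1 = p - j := by omega
    -- Each mean value inequality from `0` lowers the order by one and gains a factor `r`; the
    -- factorials of Taylor's formula are given up.
    have := (convex_closedBall (0 : V) r).norm_image_sub_le_of_norm_fderiv_le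
      (f := iteratedFDeriv ℝ (p - (j + 1)) g) (𝕜 := ℝ) (C := M * r ^ j) (x := 0) (y := y)
      (fun z _ => hd z) (fun z hz => by
        rw [norm_fderiv_iteratedFDeriv, hsucc]
        exact ih (by omega) z (by simpa using hz)) (by simpa using hr) (by simpa using hy)
    rw [h0 _ hlt, sub_zero, sub_zero] at this
    refine this.trans ?_
    rw [pow_succ, ← mul_assoc]
    exact mul_le_mul_of_nonneg_left hy (by positivity)

/-- Homogeneous polynomials are smooth. -/
theorem contDiff_diagonal {r : ℕ} (M : ContinuousMultilinearMap ℝ (fun _ : Fin r => V) F)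
    {k : WithTop ℕ∞} : ContDiff ℝ k fun s => M fun _ => s :=
  M.contDiff.comp (contDiff_pi.2 fun _ => contDiff_id)

/-- The derivative of order `r` is a sum of permuted copies of `M`, independent of the base point,
so one more differentiation kills it. -/
theorem iteratedFDeriv_diagonal_of_lt {r k : ℕ}
    (M : ContinuousMultilinearMap ℝ (fun _ : Fin r => V) F) (h : r < k) :
    iteratedFDeriv ℝ k (fun s => M fun _ => s) = 0 := by
  induction k, h using Nat.le_induction with
  | base =>
    have hc : iteratedFDeriv ℝ r (fun s => M fun _ => s)
        = fun _ => iteratedFDeriv ℝ r (fun s => M fun _ => s) 0 := by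
      funext x
      ext v
      rw [M.iteratedFDeriv_comp_diagonal, M.iteratedFDeriv_comp_diagonal]
    funext x
    ext v
    rw [iteratedFDeriv_succ_apply_left, hc]
    simp
  | succ k _ ih =>
    funext x
    ext v
    rw [iteratedFDeriv_succ_apply_left, ih]
    simp

/-- The derivative of order `k` of `M` is bounded by a multiple of `‖x‖ ^ (r - k)`, which vanishes
at the origin. -/
theorem iteratedFDeriv_diagonal_zero_of_gt {r k : ℕ}
    (M : ContinuousMultilinearMap ℝ (fun _ : Fin r => V) F) (h : k < r) :
    iteratedFDeriv ℝ k (fun s => M fun _ => s) 0 = 0 := by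
  let g : V →L[ℝ] (Fin r → V) := ContinuousLinearMap.pi fun _ => ContinuousLinearMap.id ℝ V
  change iteratedFDeriv ℝ k (M ∘ g) 0 = 0
  rw [ContinuousLinearMap.iteratedFDeriv_comp_right _ M.contDiff _ le_rfl]
  have := M.norm_iteratedFDeriv_le k (g 0)
  rw [map_zero, norm_zero, Fintype.card_fin, zero_pow (by omega), mul_zero] at this
  rw [map_zero, norm_le_zero_iff.1 this]
  ext v
  simp

end Calculus

variable {n p : ℕ}

/-! ### Symmetrization and the inexact Taylor polynomial -/

theorem symmetrize_apply {r : ℕ} (T : Tensor n r) (v : Fin r → E n) :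
    symmetrize T v = (1 / (r ! : ℝ)) * ∑ τ : Equiv.Perm (Fin r), T fun i => v (τ i) := by
  simp [symmetrize]

theorem symmetrize_of_symmetric {r : ℕ} {T : Tensor n r}
    (hT : ∀ (τ : Equiv.Perm (Fin r)) v, T (v ∘ τ) = T v) : symmetrize T = T := by
  ext v
  have h : ∀ τ : Equiv.Perm (Fin r), (T fun i => v (τ i)) = T v := fun τ => hT τ v
  have hr : (r ! : ℝ) ≠ 0 := by exact_mod_cast r.factorial_ne_zero
  rw [symmetrize_apply, Finset.sum_congr rfl fun τ _ => h τ]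
  simp [Fintype.card_perm, hr]

theorem symmetrize_comp_perm {r : ℕ} (T : Tensor n r) (τ : Equiv.Perm (Fin r)) (v : Fin r → E n) :
    symmetrize T (v ∘ τ) = symmetrize T v := by
  rw [symmetrize_apply, symmetrize_apply]
  congr 1
  exact Fintype.sum_equiv (Equiv.mulLeft τ) _ _ fun _ => rfl

/-- Symmetrization does not increase the distance to a symmetric tensor. -/
theorem norm_symmetrize_sub_le {r : ℕ} {T S : Tensor n r} {C : ℝ} (hC : 0 ≤ C)
    (hS : ∀ (τ : Equiv.Perm (Fin r)) v, S (v ∘ τ) = S v)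
    (h : ∀ v, |T v - S v| ≤ C * ∏ i, ‖v i‖) : ‖symmetrize T - S‖ ≤ C := by
  refine ContinuousMultilinearMap.opNorm_le_bound hC fun v => ?_
  have hr : (0 : ℝ) < r ! := by exact_mod_cast r.factorial_pos
  have h1 : (symmetrize T - S) v
      = (1 / (r ! : ℝ)) * ∑ τ : Equiv.Perm (Fin r), (T (v ∘ τ) - S (v ∘ τ)) := by
    rw [_root_.sub_apply, ← congrArg (fun A : Tensor n r => A v)
      (symmetrize_of_symmetric hS), symmetrize_apply, symmetrize_apply, ← mul_sub,
      ← Finset.sum_sub_distrib]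
    rfl
  have h2 : ∀ τ : Equiv.Perm (Fin r), |T (v ∘ τ) - S (v ∘ τ)| ≤ C * ∏ i, ‖v i‖ := fun τ => by
    refine (h _).trans_eq ?_
    congr 1
    exact Equiv.prod_comp τ fun i => ‖v i‖
  rw [h1, Real.norm_eq_abs, abs_mul, abs_of_pos (by positivity)]
  calc (1 / (r ! : ℝ)) * |∑ τ : Equiv.Perm (Fin r), (T (v ∘ τ) - S (v ∘ τ))|
      ≤ (1 / (r ! : ℝ)) * ∑ τ : Equiv.Perm (Fin r), C * ∏ i, ‖v i‖ := by
        gcongr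
        exact (Finset.abs_sum_le_sum_abs _ _).trans (Finset.sum_le_sum fun τ _ => h2 τ)
    _ = C * ∏ i, ‖v i‖ := by
        simp only [Finset.sum_const, Finset.card_univ, Fintype.card_perm, Fintype.card_fin,
          nsmul_eq_mul]
        field_simp

theorem contDiff_approxTaylor (f₀ : ℝ) (J : Jet n) (T : Tensor n p) {k : WithTop ℕ∞} :
    ContDiff ℝ k (approxTaylor f₀ J T) := by
  unfold approxTaylor
  refine (contDiff_const.add (ContDiff.sum fun i _ => ?_)).add ?_
  · exact contDiff_const.mul (contDiff_diagonal _)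
  · exact contDiff_const.mul (contDiff_diagonal _)

/-- The derivative of `(1 / r!) T[s]^r` of order `r`. -/
theorem iteratedFDeriv_diagonal_self {r : ℕ} (T : Tensor n r) (s : E n) :
    (1 / (r ! : ℝ)) • iteratedFDeriv ℝ r (fun s => T fun _ => s) s = symmetrize T := by
  ext v
  rw [_root_.smul_apply, T.iteratedFDeriv_comp_diagonal, symmetrize_apply,
    smul_eq_mul]

theorem iteratedFDeriv_approxTaylor (f₀ : ℝ) (J : Jet n) (T : Tensor n p) {k : ℕ} (hk : k ≠ 0)
    (s : E n) :
    iteratedFDeriv ℝ k (approxTaylor f₀ J T) s =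
      ∑ i ∈ Finset.Icc 1 (p - 1),
        (1 / (i ! : ℝ)) • iteratedFDeriv ℝ k (fun s => J i fun _ => s) s
      + (1 / (p ! : ℝ)) • iteratedFDeriv ℝ k (fun s => T fun _ => s) s := by
  have hJ : ∀ i ∈ Finset.Icc 1 (p - 1), ContDiffAt ℝ k
      (fun s => (1 / (i ! : ℝ)) • J i fun _ => s) s := fun i _ =>
    ((contDiff_diagonal (J i)).const_smul _).contDiffAt
  have hT : ContDiffAt ℝ k (fun s => (1 / (p ! : ℝ)) • T fun _ => s) s :=
    ((contDiff_diagonal T).const_smul _).contDiffAt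
  have hJs : ContDiffAt ℝ k (fun s => ∑ i ∈ Finset.Icc 1 (p - 1),
      (1 / (i ! : ℝ)) • J i fun _ => s) s := ContDiffAt.sum hJ
  have hc : ContDiffAt ℝ k (fun _ : E n => f₀) s := contDiffAt_const
  have h1 : approxTaylor f₀ J T = ((fun _ => f₀) + fun s => ∑ i ∈ Finset.Icc 1 (p - 1),
      (1 / (i ! : ℝ)) • J i fun _ => s) + fun s => (1 / (p ! : ℝ)) • T fun _ => s := by
    funext s
    simp [approxTaylor]
  have hcJ : ContDiffAt ℝ k ((fun _ : E n => f₀) + fun s => ∑ i ∈ Finset.Icc 1 (p - 1),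
      (1 / (i ! : ℝ)) • J i fun _ => s) s := hc.add hJs
  rw [h1, iteratedFDeriv_add_apply hcJ hT, iteratedFDeriv_add_apply hc hJs,
    iteratedFDeriv_fun_sum_apply hJ, iteratedFDeriv_const_of_ne hk,
    iteratedFDeriv_const_smul_apply' (contDiff_diagonal T).contDiffAt]
  simp only [Pi.zero_apply, zero_add]
  congr 1
  exact Finset.sum_congr rfl fun i _ =>
    iteratedFDeriv_const_smul_apply' (contDiff_diagonal (J i)).contDiffAt

theorem iteratedFDeriv_approxTaylor_zero (f₀ : ℝ) (J : Jet n) (T : Tensor n p) {k : ℕ}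
    (hk : k ≠ 0) (hkp : k < p) :
    iteratedFDeriv ℝ k (approxTaylor f₀ J T) 0 = symmetrize (J k) := by
  rw [iteratedFDeriv_approxTaylor f₀ J T hk, iteratedFDeriv_diagonal_zero_of_gt T hkp, smul_zero,
    add_zero, Finset.sum_eq_single_of_mem k (Finset.mem_Icc.2 ⟨by omega, by omega⟩),
    iteratedFDeriv_diagonal_self]
  intro i _ hik
  rcases lt_or_gt_of_ne hik with h | h
  · rw [iteratedFDeriv_diagonal_of_lt _ h, Pi.zero_apply, smul_zero]
  · rw [iteratedFDeriv_diagonal_zero_of_gt _ h, smul_zero]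

theorem iteratedFDeriv_approxTaylor_top (f₀ : ℝ) (J : Jet n) (T : Tensor n p) (hp : p ≠ 0)
    (s : E n) : iteratedFDeriv ℝ p (approxTaylor f₀ J T) s = symmetrize T := by
  rw [iteratedFDeriv_approxTaylor f₀ J T hp, iteratedFDeriv_diagonal_self,
    Finset.sum_eq_zero, zero_add]
  intro i hi
  rw [Finset.mem_Icc] at hi
  rw [iteratedFDeriv_diagonal_of_lt _ (by omega), Pi.zero_apply, smul_zero]

theorem approxTaylor_zero (f₀ : ℝ) (J : Jet n) (T : Tensor n p) (hp : p ≠ 0) :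
    approxTaylor f₀ J T 0 = f₀ := by
  have h : ∀ {r : ℕ}, r ≠ 0 → ∀ M : Tensor n r, (M fun _ => (0 : E n)) = 0 := fun {r} hr M =>
    M.map_coord_zero (⟨0, Nat.pos_of_ne_zero hr⟩ : Fin r) rfl
  rw [approxTaylor, h hp, Finset.sum_eq_zero]
  · simp
  · intro i hi
    rw [Finset.mem_Icc] at hi
    rw [h (by omega), mul_zero]

/-- The distance between `f` and its inexact Taylor polynomial, for derivatives of all orders
up to `p`. -/
theorem norm_iteratedFDeriv_sub_approxTaylor_le {f : E n → ℝ} (hp : p ≠ 0)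
    (hf : ContDiff ℝ p f) {L : ℝ} (hL : 0 ≤ L)
    (hlip : ∀ x y, ‖iteratedFDeriv ℝ p f x - iteratedFDeriv ℝ p f y‖ ≤ L * ‖x - y‖)
    (x : E n) (J : Jet n) (hJ : ∀ i, i ≠ 0 → i < p → J i = iteratedFDeriv ℝ i f x)
    {T : Tensor n p} (hT : symmetrize T = T) (s : E n) {j : ℕ} (hj : j ≤ p) :
    ‖iteratedFDeriv ℝ (p - j) f (x + s) - iteratedFDeriv ℝ (p - j) (approxTaylor (f x) J T) s‖
      ≤ (L * ‖s‖ + ‖T - iteratedFDeriv ℝ p f x‖) * ‖s‖ ^ j := by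
  have hshift : ContDiff ℝ p fun s => f (x + s) := hf.comp (contDiff_const.add contDiff_id)
  have hsub : ∀ i ≤ p, ∀ s, iteratedFDeriv ℝ i
      ((fun s => f (x + s)) - approxTaylor (f x) J T) s
        = iteratedFDeriv ℝ i f (x + s) - iteratedFDeriv ℝ i (approxTaylor (f x) J T) s := by
    intro i hi s
    rw [iteratedFDeriv_sub_apply (hshift.of_le (by exact_mod_cast hi)).contDiffAt
      (contDiff_approxTaylor _ _ _).contDiffAt, iteratedFDeriv_comp_add_left]
  rw [← hsub _ (Nat.sub_le _ _)]
  -- The difference has zero derivatives of order below `p` at `0`, because derivatives of `f` are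
  -- already symmetric. Its derivative of order `p` is the variation of `∇^p f` minus the constant
  -- tensor error.
  refine norm_iteratedFDeriv_le_of_vanish
    (g := (fun s => f (x + s)) - approxTaylor (f x) J T)
    (hshift.sub (contDiff_approxTaylor _ _ _)) ?_
    (norm_nonneg s) ?_ j hj s le_rfl
  · intro i hi
    rw [hsub i hi.le, add_zero]
    rcases eq_or_ne i 0 with rfl | hi0
    · ext v
      simp [approxTaylor_zero _ _ _ hp]
    · rw [iteratedFDeriv_approxTaylor_zero _ _ _ hi0 hi, hJ i hi0 hi, symmetrize_of_symmetric,
        sub_self]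
      exact fun τ v => iteratedFDeriv_comp_perm (hf.of_le (by exact_mod_cast hi.le)) x τ v
  · intro y hy
    rw [hsub p le_rfl, iteratedFDeriv_approxTaylor_top _ _ _ hp, hT]
    have h1 := hlip (x + y) x
    rw [add_sub_cancel_left] at h1
    calc ‖iteratedFDeriv ℝ p f (x + y) - T‖
        = ‖(iteratedFDeriv ℝ p f (x + y) - iteratedFDeriv ℝ p f x)
            - (T - iteratedFDeriv ℝ p f x)‖ := by congr 1; abel
      _ ≤ L * ‖y‖ + ‖T - iteratedFDeriv ℝ p f x‖ := (norm_sub_le _ _).trans (by gcongr)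
      _ ≤ L * ‖s‖ + ‖T - iteratedFDeriv ℝ p f x‖ := by gcongr

/-! ### Gradient and curvature -/

theorem norm_gradient_sub_le (f g : E n → ℝ) (x y : E n) :
    ‖gradient f x‖ ≤ ‖gradient g y‖ + ‖iteratedFDeriv ℝ 1 f x - iteratedFDeriv ℝ 1 g y‖ := by
  have h : ‖fderiv ℝ f x - fderiv ℝ g y‖ ≤ ‖iteratedFDeriv ℝ 1 f x - iteratedFDeriv ℝ 1 g y‖ := by
    refine ContinuousLinearMap.opNorm_le_bound _ (norm_nonneg _) fun v => ?_
    simpa using (iteratedFDeriv ℝ 1 f x - iteratedFDeriv ℝ 1 g y).le_opNorm fun _ => v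
  unfold gradient
  rw [LinearIsometryEquiv.norm_map, LinearIsometryEquiv.norm_map]
  have h2 := norm_add_le (fderiv ℝ g y) (fderiv ℝ f x - fderiv ℝ g y)
  rw [add_sub_cancel] at h2
  linarith

theorem iteratedFDeriv_one_diagonal_ge (f : E n → ℝ) (x s : E n) :
    -(‖gradient f x‖ * ‖s‖) ≤ iteratedFDeriv ℝ 1 f x fun _ => s := by
  have h := (iteratedFDeriv ℝ 1 f x).le_opNorm fun _ => s
  have hg : ‖gradient f x‖ = ‖iteratedFDeriv ℝ 1 f x‖ := by
    unfold gradient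
    rw [LinearIsometryEquiv.norm_map, norm_iteratedFDeriv_one]
  rw [hg]
  simp only [Finset.univ_unique, Finset.prod_const, Finset.card_singleton, pow_one] at h
  exact neg_le_of_abs_le h

/-- Both sides say that `A - b I` is positive semidefinite, its spectrum being that of `A` shifted
by `b`. The case `n = 0` is excluded because `sInf ∅ = 0`. -/
theorem lambdaMin_ge_iff (hn : 1 ≤ n) {A : Matrix (Fin n) (Fin n) ℝ} (hA : A.IsHermitian)
    (b : ℝ) : b ≤ lambdaMin A ↔ ∀ v : Fin n → ℝ, b * (v ⬝ᵥ v) ≤ v ⬝ᵥ A.mulVec v := by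
  have : Nonempty (Fin n) := ⟨⟨0, hn⟩⟩
  have hspec := hA.spectrum_real_eq_range_eigenvalues
  have hherm : (A - algebraMap ℝ (Matrix (Fin n) (Fin n) ℝ) b).IsHermitian := by
    refine hA.sub ?_
    rw [Matrix.algebraMap_eq_diagonal]
    exact Matrix.isHermitian_diagonal _
  have hpsd : (A - algebraMap ℝ _ b).PosSemidef ↔
      ∀ v : Fin n → ℝ, b * (v ⬝ᵥ v) ≤ v ⬝ᵥ A.mulVec v := by
    rw [Matrix.posSemidef_iff_dotProduct_mulVec, and_iff_right hherm]
    simp only [Matrix.sub_mulVec, Algebra.algebraMap_eq_smul_one,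
      Matrix.smul_mulVec, Matrix.one_mulVec, dotProduct_sub, dotProduct_smul, smul_eq_mul,
      star_trivial, sub_nonneg]
  rw [← hpsd, Matrix.posSemidef_iff_isHermitian_and_spectrum_nonneg]
  have hfin : (spectrum ℝ A).Finite := by rw [hspec]; exact Set.finite_range _
  have hne : (spectrum ℝ A).Nonempty := by rw [hspec]; exact Set.range_nonempty _
  rw [lambdaMin, le_csInf_iff hfin.bddBelow hne]
  simp only [hherm, true_and]
  constructor
  · intro h a ha
    rw [← spectrum.sub_singleton_eq, Set.mem_sub] at ha
    obtain ⟨c, hc, d, hd, rfl⟩ := ha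
    rw [Set.mem_singleton_iff.1 hd]
    exact sub_nonneg.2 (h c hc)
  · intro h c hc
    have : c - b ∈ spectrum ℝ (A - algebraMap ℝ _ b) := by
      rw [← spectrum.sub_singleton_eq]
      exact Set.sub_mem_sub hc rfl
    exact sub_nonneg.1 (h this)

theorem hessian_isHermitian {g : E n → ℝ} (hg : ContDiff ℝ 2 g) (x : E n) :
    (hessian g x).IsHermitian := by
  ext i j
  simp only [Matrix.conjTranspose_apply, hessian, Matrix.of_apply, star_trivial]
  have h := iteratedFDeriv_comp_perm (k := 2) hg x (Equiv.swap 0 1) ![e i, e j]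
  rw [← h]
  congr 1
  funext k
  fin_cases k <;> simp

theorem hessian_quadratic (g : E n → ℝ) (x : E n) (v : E n) :
    v.ofLp ⬝ᵥ (hessian g x).mulVec v.ofLp = iteratedFDeriv ℝ 2 g x fun _ => v := by
  have hv : v = ∑ i, v i • (e i : E n) := by
    ext j
    simp [e, Finset.sum_apply, Pi.single_apply]
  have h2 : (iteratedFDeriv ℝ 2 g x fun _ => v)
      = fderiv ℝ (fderiv ℝ g) x v v := iteratedFDeriv_two_apply _ _ _
  rw [h2]
  conv_rhs => rw [hv]
  simp only [map_sum, map_smul, _root_.sum_apply, _root_.smul_apply,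
    dotProduct, Matrix.mulVec, hessian, Matrix.of_apply, iteratedFDeriv_two_apply, smul_eq_mul,
    Matrix.cons_val_zero, Matrix.cons_val_one, Finset.mul_sum]
  rw [Finset.sum_comm]
  exact Finset.sum_congr rfl fun i _ => Finset.sum_congr rfl fun j _ => by ring

theorem lambdaMin_hessian_ge_iff (hn : 1 ≤ n) {g : E n → ℝ} (hg : ContDiff ℝ 2 g) (x : E n)
    (b : ℝ) : b ≤ lambdaMin (hessian g x) ↔
      ∀ v : E n, b * ‖v‖ ^ 2 ≤ iteratedFDeriv ℝ 2 g x fun _ => v := by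
  have hnorm : ∀ v : E n, v.ofLp ⬝ᵥ v.ofLp = ‖v‖ ^ 2 := fun v => by
    rw [EuclideanSpace.norm_sq_eq]
    simp [dotProduct, sq]
  rw [lambdaMin_ge_iff hn (hessian_isHermitian hg x)]
  constructor
  · intro h v
    rw [← hessian_quadratic, ← hnorm]
    exact h _
  · intro h v
    have := h (WithLp.toLp 2 v)
    rwa [← hessian_quadratic, ← hnorm] at this

/-- Weyl's perturbation inequality, through the quadratic-form characterization. -/
theorem lambdaMin_hessian_sub_le (hn : 1 ≤ n) {f g : E n → ℝ} (hf : ContDiff ℝ 2 f)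
    (hg : ContDiff ℝ 2 g) (x y : E n) :
    lambdaMin (hessian g y) - ‖iteratedFDeriv ℝ 2 f x - iteratedFDeriv ℝ 2 g y‖
      ≤ lambdaMin (hessian f x) := by
  rw [lambdaMin_hessian_ge_iff hn hf]
  intro v
  have h1 := (lambdaMin_hessian_ge_iff hn hg y _).1 le_rfl v
  have h2 := (iteratedFDeriv ℝ 2 f x - iteratedFDeriv ℝ 2 g y).le_opNorm fun _ => v
  rw [_root_.sub_apply, Finset.prod_const, Finset.card_univ,
    Fintype.card_fin] at h2
  have h3 := neg_le_of_abs_le h2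
  linarith

/-! ### Finite differences -/

theorem norm_sub_sub_fderiv_iteratedFDeriv_le {q : ℕ} {f : E n → ℝ}
    (hf : ContDiff ℝ (q + 1 : ℕ) f) {L : ℝ} (hL : 0 ≤ L)
    (hlip : ∀ x y, ‖iteratedFDeriv ℝ (q + 1) f x - iteratedFDeriv ℝ (q + 1) f y‖ ≤ L * ‖x - y‖)
    (x d : E n) :
    ‖iteratedFDeriv ℝ q f (x + d) - iteratedFDeriv ℝ q f x
      - fderiv ℝ (iteratedFDeriv ℝ q f) x d‖ ≤ L * ‖d‖ * ‖d‖ := by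
  have hd : Differentiable ℝ (iteratedFDeriv ℝ q f) :=
    hf.differentiable_iteratedFDeriv (by exact_mod_cast Nat.lt_succ_self q)
  have hl : ∀ y, ‖fderiv ℝ (iteratedFDeriv ℝ q f) y - fderiv ℝ (iteratedFDeriv ℝ q f) x‖
      ≤ L * ‖y - x‖ := by
    intro y
    refine ContinuousLinearMap.opNorm_le_bound _ (by positivity) fun u => ?_
    refine ContinuousMultilinearMap.opNorm_le_bound (by positivity) fun w => ?_
    have h := (iteratedFDeriv ℝ (q + 1) f y - iteratedFDeriv ℝ (q + 1) f x).le_opNorm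
      (Fin.cons u w : Fin (q + 1) → E n)
    rw [_root_.sub_apply, iteratedFDeriv_succ_apply_left, iteratedFDeriv_succ_apply_left,
      Fin.cons_zero, Fin.tail_cons, Fin.prod_univ_succ, Fin.cons_zero] at h
    simp only [Fin.cons_succ] at h
    refine h.trans ?_
    rw [mul_assoc]
    exact mul_le_mul_of_nonneg_right (hlip y x) (by positivity)
  have h : ‖iteratedFDeriv ℝ q f (x + d) - iteratedFDeriv ℝ q f x
      - fderiv ℝ (iteratedFDeriv ℝ q f) x (x + d - x)‖ ≤ L * ‖d‖ * ‖x + d - x‖ :=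
    (convex_closedBall x ‖d‖).norm_image_sub_le_of_norm_fderiv_le' (fun z _ => hd z) (fun z hz => (hl z).trans (by
      rw [mem_closedBall_iff_norm] at hz
      gcongr)) (by simp) (by simp)
  rwa [add_sub_cancel_left] at h

/-- Cauchy–Schwarz; this is the factor `√n` that the denominator of `h_k` cancels. -/
theorem sum_abs_coord_le (v : E n) : ∑ i, |v i| ≤ Real.sqrt n * ‖v‖ := by
  have h := sq_sum_le_card_mul_sum_sq (s := (Finset.univ : Finset (Fin n))) (f := fun i => |v i|)
  simp only [sq_abs, Finset.card_univ, Fintype.card_fin] at h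
  rw [EuclideanSpace.norm_eq, ← Real.sqrt_mul (Nat.cast_nonneg n)]
  refine Real.le_sqrt_of_sq_le ?_
  simpa using h

/-- `iteratedFDeriv` puts the newest direction in the first slot, whereas `⊗ eᵢ` uses the last one.
A rotation and the symmetry of the derivative reconcile the two. -/
theorem iteratedFDeriv_succ_apply_last {q : ℕ} {f : E n → ℝ} (hf : ContDiff ℝ (q + 1 : ℕ) f)
    (x : E n) (v : Fin (q + 1) → E n) :
    iteratedFDeriv ℝ (q + 1) f x v
      = ∑ i, v (Fin.last q) i *
          fderiv ℝ (iteratedFDeriv ℝ q f) x (e i) (fun j => v j.castSucc) := by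
  have hv : v = (Fin.cons (v (Fin.last q)) (Fin.init v) : Fin (q + 1) → E n)
      ∘ finRotate (q + 1) := by
    conv_lhs => rw [← Fin.snoc_init_self v, Fin.snoc_eq_cons_rotate]
    rfl
  have he : v (Fin.last q) = ∑ i, v (Fin.last q) i • (e i : E n) := by
    ext j
    simp [e, Finset.sum_apply, Pi.single_apply]
  conv_lhs => rw [hv]
  rw [iteratedFDeriv_comp_perm hf, iteratedFDeriv_succ_apply_left, Fin.cons_zero, Fin.tail_cons]
  conv_lhs => rw [he]
  simp [map_sum, Fin.init_def]

/-- The symmetrized finite-difference tensor approximates the derivative of order `p` with an error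
that depends on the dimension only through `√n * h`. -/
theorem norm_symmetrize_fdTensor_sub_le {f : E n → ℝ} (hp : 2 ≤ p) (hf : ContDiff ℝ p f)
    {L : ℝ} (hL : 0 ≤ L)
    (hlip : ∀ x y, ‖iteratedFDeriv ℝ p f x - iteratedFDeriv ℝ p f y‖ ≤ L * ‖x - y‖)
    {h : ℝ} (hh : 0 < h) (x : E n) :
    ‖symmetrize (fdTensor h (derivOracle p f x) (fun i => derivOracle p f (x + h • e i)) p)
      - iteratedFDeriv ℝ p f x‖ ≤ L * (Real.sqrt n * h) := by
  obtain ⟨q, rfl⟩ : ∃ q, p = q + 1 := ⟨p - 1, by omega⟩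
  refine norm_symmetrize_sub_le (by positivity) (fun τ v => iteratedFDeriv_comp_perm hf x τ v)
    fun v => ?_
  have horacle : ∀ y, derivOracle (q + 1) f y q = iteratedFDeriv ℝ q f y := fun y =>
    if_pos ⟨by omega, by omega⟩
  set w : Fin q → E n := fun j => v j.castSucc with hw
  have hprod : 0 ≤ ∏ j, ‖w j‖ := Finset.prod_nonneg fun _ _ => norm_nonneg _
  have hterm : ∀ i : Fin n,
      |(h⁻¹ • (iteratedFDeriv ℝ q f (x + h • e i) - iteratedFDeriv ℝ q f x)) w
        - fderiv ℝ (iteratedFDeriv ℝ q f) x (e i) w| ≤ L * h * ∏ j, ‖w j‖ := by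
    intro i
    have hnorm : ‖h • (e i : E n)‖ = h := by
      rw [norm_smul, Real.norm_of_nonneg hh.le]; simp [e]
    have h1 := norm_sub_sub_fderiv_iteratedFDeriv_le hf hL hlip x (h • e i)
    rw [hnorm, map_smul] at h1
    have h2 : (h⁻¹ • (iteratedFDeriv ℝ q f (x + h • e i) - iteratedFDeriv ℝ q f x)) w
        - fderiv ℝ (iteratedFDeriv ℝ q f) x (e i) w
        = h⁻¹ * ((iteratedFDeriv ℝ q f (x + h • e i) - iteratedFDeriv ℝ q f x
          - h • fderiv ℝ (iteratedFDeriv ℝ q f) x (e i)) w) := by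
      simp only [_root_.smul_apply, _root_.sub_apply, smul_eq_mul]
      field_simp
    rw [h2, abs_mul, abs_of_pos (inv_pos.2 hh)]
    calc h⁻¹ * |(iteratedFDeriv ℝ q f (x + h • e i) - iteratedFDeriv ℝ q f x
          - h • fderiv ℝ (iteratedFDeriv ℝ q f) x (e i)) w|
        ≤ h⁻¹ * ((L * h * h) * ∏ j, ‖w j‖) := by
          refine mul_le_mul_of_nonneg_left ?_ (inv_nonneg.2 hh.le)
          exact (ContinuousMultilinearMap.le_opNorm _ _).trans
            (mul_le_mul_of_nonneg_right h1 hprod)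
      _ = L * h * ∏ j, ‖w j‖ := by field_simp
  have hfd : fdTensor h (derivOracle (q + 1) f x)
      (fun i => derivOracle (q + 1) f (x + h • e i)) (q + 1) v
      = ∑ i, (h⁻¹ • (iteratedFDeriv ℝ q f (x + h • e i) - iteratedFDeriv ℝ q f x)) w
          * v (Fin.last q) i := by
    simp only [fdTensor, horacle, _root_.sum_apply, tensorBasis_apply, hw]
  rw [hfd, iteratedFDeriv_succ_apply_last hf, ← Finset.sum_sub_distrib]
  -- Each coordinate contributes an error `L h` weighted by the coordinate of the last argument, so
  -- the `ℓ¹` norm of that argument appears rather than a factor `n`.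
  calc |∑ i, ((h⁻¹ • (iteratedFDeriv ℝ q f (x + h • e i) - iteratedFDeriv ℝ q f x)) w
          * v (Fin.last q) i - v (Fin.last q) i * fderiv ℝ (iteratedFDeriv ℝ q f) x (e i) w)|
      ≤ ∑ i, (L * h * ∏ j, ‖w j‖) * |v (Fin.last q) i| := by
        refine (Finset.abs_sum_le_sum_abs _ _).trans (Finset.sum_le_sum fun i _ => ?_)
        rw [mul_comm (v (Fin.last q) i), ← sub_mul, abs_mul]
        exact mul_le_mul_of_nonneg_right (hterm i) (abs_nonneg _)
    _ = (L * h * ∏ j, ‖w j‖) * ∑ i, |v (Fin.last q) i| := by rw [Finset.mul_sum]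
    _ ≤ (L * h * ∏ j, ‖w j‖) * (Real.sqrt n * ‖v (Fin.last q)‖) :=
        mul_le_mul_of_nonneg_left (sum_abs_coord_le _) (by positivity)
    _ = L * (Real.sqrt n * h) * ∏ i, ‖v i‖ := by
        rw [Fin.prod_univ_castSucc]; ring

/-! ### The oracle programs -/

theorem OracleProg.result_queryAll {Q A α : Type} (O : Q → A) :
    ∀ (r : ℕ) (q : Fin r → Q) (cont : (Fin r → A) → OracleProg Q A α),
      (OracleProg.queryAll r q cont).result O = (cont fun i => O (q i)).result O := by
  intro r
  induction r with
  | zero =>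
    intro q cont
    rw [OracleProg.queryAll]
    congr 2
    exact Subsingleton.elim _ _
  | succ r ih =>
    intro q cont
    rw [OracleProg.queryAll, OracleProg.result, ih]
    congr 2
    funext i
    refine Fin.cases ?_ (fun j => ?_) i <;> simp

theorem OracleProg.calls_queryAll {Q A α : Type} (O : Q → A) :
    ∀ (r : ℕ) (q : Fin r → Q) (cont : (Fin r → A) → OracleProg Q A α),
      (OracleProg.queryAll r q cont).calls O = (cont fun i => O (q i)).calls O + r := by
  intro r
  induction r with
  | zero =>
    intro q cont
    rw [OracleProg.queryAll, Nat.add_zero]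
    congr 2
    exact Subsingleton.elim _ _
  | succ r ih =>
    intro q cont
    rw [OracleProg.queryAll, OracleProg.calls, ih, Nat.add_assoc]
    congr 3
    funext i
    refine Fin.cases ?_ (fun j => ?_) i <;> simp

theorem result_runIteration_fst (m : ℕ) (f : E n → ℝ) (x s : ℕ → E n) (T : ℕ → Tensor n p)
    (k : ℕ) : ((runIteration m x s T k).result (derivOracle p f)).1 = derivOracle p f (x k) := by
  unfold runIteration iteration
  rw [OracleProg.result]
  split_ifs
  · rw [OracleProg.result_queryAll]; rfl
  · rfl

theorem result_runIteration_snd (m : ℕ) (f : E n → ℝ) (x s : ℕ → E n) (T : ℕ → Tensor n p)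
    (k : ℕ) : ((runIteration m x s T k).result (derivOracle p f)).2 =
      if k % m = 0 then symmetrize (fdTensor (fdStep m s k) (derivOracle p f (x k))
        (fun i => derivOracle p f (x k + fdStep m s k • e i)) p) else T (k - 1) := by
  unfold runIteration iteration
  rw [OracleProg.result]
  split_ifs
  · rw [OracleProg.result_queryAll]; rfl
  · rfl

theorem calls_runIteration_le (m : ℕ) (f : E n → ℝ) (x s : ℕ → E n) (T : ℕ → Tensor n p)
    (k : ℕ) : (runIteration m x s T k).calls (derivOracle p f) ≤ n + 1 := by
  unfold runIteration iteration
  rw [OracleProg.calls]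
  split_ifs
  · rw [OracleProg.calls_queryAll]; simp [OracleProg.calls]
  · simp [OracleProg.calls]

theorem evaluations_le (hn : 1 ≤ n) (m : ℕ) (f : E n → ℝ) (x s : ℕ → E n)
    (T : ℕ → Tensor n p) (N : ℕ) : (evaluations m f x s T N : ℝ) ≤ 2 * n * N := by
  have h : evaluations m f x s T N ≤ ∑ _k ∈ Finset.range N, (n + 1) :=
    Finset.sum_le_sum fun k _ => calls_runIteration_le m f x s T k
  rw [Finset.sum_const, Finset.card_range, smul_eq_mul] at h
  have h2 : N * (n + 1) ≤ 2 * n * N := by nlinarith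
  exact_mod_cast h.trans h2

/-! ### Accuracy of the tensors along a run -/

theorem stepNorm_nonneg (s : ℕ → E n) (j : ℤ) : 0 ≤ stepNorm s j := by
  unfold stepNorm
  split_ifs
  · exact norm_nonneg _
  · exact zero_le_one

theorem stepNorm_natCast (s : ℕ → E n) (k : ℕ) : stepNorm s (k : ℤ) = ‖s k‖ := by
  simp [stepNorm]

/-- The sum of the last `2 m + 1` step lengths, the current one included. -/
noncomputable def window (m : ℕ) (s : ℕ → E n) (k : ℕ) : ℝ :=
  ∑ i ∈ Finset.range (2 * m + 1), stepNorm s ((k : ℤ) - (i : ℕ))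

theorem norm_le_window (m : ℕ) (s : ℕ → E n) (k : ℕ) : ‖s k‖ ≤ window m s k := by
  have h := Finset.single_le_sum (f := fun i : ℕ => stepNorm s ((k : ℤ) - (i : ℕ)))
    (fun i _ => stepNorm_nonneg s _) (Finset.mem_range.2 (Nat.succ_pos (2 * m)))
  simpa [stepNorm_natCast, window] using h

theorem sqrt_mul_fdStep_le (hn : 1 ≤ n) (m : ℕ) (s : ℕ → E n) (k : ℕ) :
    Real.sqrt n * fdStep m s k
      ≤ ∑ i ∈ Finset.range m, stepNorm s ((k : ℤ) - 1 - (i : ℕ)) := by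
  have hn' : (0 : ℝ) < n := by exact_mod_cast hn
  have hsq : Real.sqrt n ≠ 0 := (Real.sqrt_pos.2 hn').ne'
  have hsum : ∑ i ∈ Finset.Icc 1 m, stepNorm s ((k : ℤ) - (i : ℕ))
      = ∑ i ∈ Finset.range m, stepNorm s ((k : ℤ) - 1 - (i : ℕ)) := by
    rw [← Finset.Ico_add_one_right_eq_Icc, Finset.sum_Ico_eq_sum_range]
    refine Finset.sum_congr (by simp) fun i _ => ?_
    congr 1
    push_cast
    ring
  rw [fdStep, mul_div_cancel₀ _ hsq, hsum]
  exact min_le_left _ _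

section Run

variable {m N : ℕ} {σ₀ θ₁ θ₂ flow L κhigh κp : ℝ} {f : E n → ℝ} {x₀ : E n}
  {x s : ℕ → E n} {σ : ℕ → ℝ} {T : ℕ → Tensor n p}

theorem IsRun.symmetrize_tensor (hrun : IsRun m σ₀ θ₁ θ₂ f x₀ N x s σ T) :
    ∀ k < N, symmetrize (T k) = T k := by
  intro k
  induction k with
  | zero =>
    intro hk
    rw [hrun.tensor 0 hk, result_runIteration_snd, if_pos (Nat.zero_mod m)]
    exact symmetrize_of_symmetric (symmetrize_comp_perm _)
  | succ k ih =>
    intro hk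
    rw [hrun.tensor _ hk, result_runIteration_snd]
    split_ifs
    · exact symmetrize_of_symmetric (symmetrize_comp_perm _)
    · exact ih (by omega)

/-- A refresh costs the `m` step lengths that define `h_k`; each iteration that keeps the tensor
moves the base point by one step, and the Lipschitz condition adds one length. The bound covers a
prefix `K` of the run, on which every refresh has a positive `h_k`. -/
theorem IsRun.norm_tensor_sub_le_sum (hp : 2 ≤ p) (hm : 1 ≤ m) (hn : 1 ≤ n) (hL : 0 ≤ L)
    (hf : ProblemAssumptions p f flow L κhigh κp)
    (hrun : IsRun m σ₀ θ₁ θ₂ f x₀ N x s σ T) {K : ℕ} (hK : K ≤ N)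
    (hpos : ∀ k < K, k % m = 0 → 0 < fdStep m s k) :
    ∀ k < K, ‖T k - iteratedFDeriv ℝ p f (x k)‖
      ≤ L * ∑ i ∈ Finset.range (m + k % m), stepNorm s ((k : ℤ) - 1 - (i : ℕ)) := by
  have hrefresh : ∀ k < K, k % m = 0 → ‖T k - iteratedFDeriv ℝ p f (x k)‖
      ≤ L * ∑ i ∈ Finset.range (m + k % m), stepNorm s ((k : ℤ) - 1 - (i : ℕ)) := by
    intro k hk hkm
    rw [hrun.tensor k (by omega), result_runIteration_snd, if_pos hkm, hkm, Nat.add_zero]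
    exact (norm_symmetrize_fdTensor_sub_le hp hf.contDiff hL hf.lipschitz (hpos k hk hkm) _).trans
      (mul_le_mul_of_nonneg_left (sqrt_mul_fdStep_le hn m s k) hL)
  intro k
  induction k with
  | zero => exact fun hk => hrefresh 0 hk (Nat.zero_mod m)
  | succ k ih =>
    intro hk
    by_cases hkm : (k + 1) % m = 0
    · exact hrefresh _ hk hkm
    have hmod : (k + 1) % m = k % m + 1 := by
      rcases Nat.lt_or_ge (k % m + 1) m with h | h
      · rw [Nat.add_mod, Nat.mod_eq_of_lt (by omega : 1 < m), Nat.mod_eq_of_lt h]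
      · exfalso
        have h1 := Nat.mod_lt k hm
        have h2 : k % m + 1 = m := by omega
        apply hkm
        rw [← Nat.mod_add_mod, h2, Nat.mod_self]
    rw [hrun.tensor _ (by omega), result_runIteration_snd, if_neg hkm, Nat.add_sub_cancel, hmod,
      ← Nat.add_assoc, Finset.sum_range_succ', mul_add]
    have h1 := hf.lipschitz (x k) (x (k + 1))
    rw [hrun.x_succ k (by omega), sub_add_cancel_left, norm_neg] at h1
    have h2 := ih (by omega)
    have e1 : stepNorm s (((k + 1 : ℕ) : ℤ) - 1 - ((0 : ℕ) : ℤ)) = ‖s k‖ := by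
      rw [← stepNorm_natCast]; congr 1; push_cast; ring
    have e2 : ∀ i : ℕ, stepNorm s (((k + 1 : ℕ) : ℤ) - 1 - ((i + 1 : ℕ) : ℤ))
        = stepNorm s ((k : ℤ) - 1 - (i : ℕ)) := by
      intro i; congr 1; push_cast; ring
    rw [e1, Finset.sum_congr rfl fun i _ => e2 i, hrun.x_succ k (by omega)]
    calc ‖T k - iteratedFDeriv ℝ p f (x k + s k)‖
        = ‖(T k - iteratedFDeriv ℝ p f (x k))
            + (iteratedFDeriv ℝ p f (x k) - iteratedFDeriv ℝ p f (x k + s k))‖ := by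
          congr 1; abel
      _ ≤ _ := (norm_add_le _ _).trans (add_le_add h2 h1)

/-- Since `k % m < m`, at most `2 m` earlier lengths are involved. Leaving out `‖s k‖` makes room
for the Taylor term `L * ‖s k‖`, and gives an error bound that does not presuppose a bound on the
current step. -/
theorem IsRun.tensor_error_le_window (hp : 2 ≤ p) (hm : 1 ≤ m) (hn : 1 ≤ n) (hL : 0 ≤ L)
    (hf : ProblemAssumptions p f flow L κhigh κp)
    (hrun : IsRun m σ₀ θ₁ θ₂ f x₀ N x s σ T) {K : ℕ} (hK : K ≤ N)
    (hpos : ∀ k < K, k % m = 0 → 0 < fdStep m s k) :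
    ∀ k < K, ‖T k - iteratedFDeriv ℝ p f (x k)‖ ≤ L * (window m s k - ‖s k‖) := by
  intro k hk
  have h := hrun.norm_tensor_sub_le_sum hp hm hn hL hf hK hpos k hk
  have h2 : ∑ i ∈ Finset.range (m + k % m), stepNorm s ((k : ℤ) - 1 - (i : ℕ))
      ≤ ∑ i ∈ Finset.range (2 * m), stepNorm s ((k : ℤ) - 1 - (i : ℕ)) := by
    refine Finset.sum_le_sum_of_subset_of_nonneg ?_ fun _ _ _ => stepNorm_nonneg _ _
    have := Nat.mod_lt k hm
    exact Finset.range_subset_range.2 (by omega)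
  have hw : window m s k
      = ∑ i ∈ Finset.range (2 * m), stepNorm s ((k : ℤ) - 1 - (i : ℕ)) + ‖s k‖ := by
    rw [window, Finset.sum_range_succ', ← stepNorm_natCast]
    congr 1
    · refine Finset.sum_congr rfl fun i _ => ?_
      congr 1; push_cast; ring
  rw [hw, add_sub_cancel_right]
  exact h.trans (mul_le_mul_of_nonneg_left h2 hL)

end Run

/-! ### Consequences of the step tests -/

section Step

variable {θ₁ θ₂ L σ : ℝ} {f : E n → ℝ} {x s : E n} {J : Jet n} {T : Tensor n p}

/-- The decrease test bounds the regularization term by `f x` minus the inexact Taylor value at `s`,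
which the remainder estimate compares with `f (x + s)`. The left side is exactly the increment of
`σ`. -/
theorem StepAccepted.decrease_le (hp : 2 ≤ p) (hs : StepAccepted θ₁ θ₂ (f x) J T σ s)
    (hf : ContDiff ℝ p f) (hL : 0 ≤ L)
    (hlip : ∀ x y, ‖iteratedFDeriv ℝ p f x - iteratedFDeriv ℝ p f y‖ ≤ L * ‖x - y‖)
    (hJ : ∀ i, i ≠ 0 → i < p → J i = iteratedFDeriv ℝ i f x) (hT : symmetrize T = T) :
    σ * ‖s‖ ^ (p + 1) ≤ ((p + 1)! : ℝ) * (f x - f (x + s)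
      + (L * ‖s‖ + ‖T - iteratedFDeriv ℝ p f x‖) * ‖s‖ ^ p) := by
  have h := norm_iteratedFDeriv_sub_approxTaylor_le (by omega) hf hL hlip x J hJ hT s le_rfl
  rw [Nat.sub_self] at h
  have h1 := (iteratedFDeriv ℝ 0 f (x + s)
    - iteratedFDeriv ℝ 0 (approxTaylor (f x) J T) s).le_opNorm 0
  simp only [_root_.sub_apply, iteratedFDeriv_zero_apply, Finset.univ_eq_empty,
    Finset.prod_empty, mul_one, Real.norm_eq_abs] at h1
  have h2 := (abs_le.1 (h1.trans h)).2
  have h3 := hs.decrease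
  simp only [model, approxTaylor_zero _ _ _ (by omega : p ≠ 0), norm_zero,
    zero_pow (Nat.succ_ne_zero p), mul_zero, add_zero] at h3
  have hfac : (0 : ℝ) < (p + 1)! := by exact_mod_cast (p + 1).factorial_pos
  rw [← div_le_iff₀' hfac, ← div_mul_eq_mul_div]
  linarith

theorem StepAccepted.norm_gradient_le (hp : 2 ≤ p) (hs : StepAccepted θ₁ θ₂ (f x) J T σ s)
    (hσ : 0 ≤ σ) (hθ₁ : 0 ≤ θ₁) (hf : ContDiff ℝ p f) (hL : 0 ≤ L)
    (hlip : ∀ x y, ‖iteratedFDeriv ℝ p f x - iteratedFDeriv ℝ p f y‖ ≤ L * ‖x - y‖)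
    (hJ : ∀ i, i ≠ 0 → i < p → J i = iteratedFDeriv ℝ i f x) (hT : symmetrize T = T) :
    ‖gradient f (x + s)‖ ≤ θ₁ * σ * ‖s‖ ^ p
      + (L * ‖s‖ + ‖T - iteratedFDeriv ℝ p f x‖) * ‖s‖ ^ (p - 1) := by
  have h := norm_iteratedFDeriv_sub_approxTaylor_le (by omega) hf hL hlip x J hJ hT s
    (Nat.sub_le p 1)
  rw [Nat.sub_sub_self (by omega)] at h
  have h1 := norm_gradient_sub_le f (approxTaylor (f x) J T) (x + s) s
  have h2 : θ₁ * σ * ‖s‖ ^ p / (p ! : ℝ) ≤ θ₁ * σ * ‖s‖ ^ p :=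
    div_le_self (by positivity) (by exact_mod_cast p.factorial_pos)
  linarith [hs.gradient_small]

theorem StepAccepted.curvature_le (hp : 2 ≤ p) (hn : 1 ≤ n)
    (hs : StepAccepted θ₁ θ₂ (f x) J T σ s)
    (hσ : 0 ≤ σ) (hθ₂ : 0 ≤ θ₂) (hf : ContDiff ℝ p f) (hL : 0 ≤ L)
    (hlip : ∀ x y, ‖iteratedFDeriv ℝ p f x - iteratedFDeriv ℝ p f y‖ ≤ L * ‖x - y‖)
    (hJ : ∀ i, i ≠ 0 → i < p → J i = iteratedFDeriv ℝ i f x) (hT : symmetrize T = T) :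
    -lambdaMin (hessian f (x + s)) ≤ θ₂ * σ * ‖s‖ ^ (p - 1)
      + (L * ‖s‖ + ‖T - iteratedFDeriv ℝ p f x‖) * ‖s‖ ^ (p - 2) := by
  have h := norm_iteratedFDeriv_sub_approxTaylor_le (by omega) hf hL hlip x J hJ hT s
    (Nat.sub_le p 2)
  rw [Nat.sub_sub_self (by omega)] at h
  have h1 := lambdaMin_hessian_sub_le hn (hf.of_le (by exact_mod_cast hp))
    (contDiff_approxTaylor (f x) J T) (x + s) s
  have h2 : θ₂ * σ * ‖s‖ ^ (p - 1) / ((p - 1)! : ℝ) ≤ θ₂ * σ * ‖s‖ ^ (p - 1) :=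
    div_le_self (by positivity) (by exact_mod_cast (p - 1).factorial_pos)
  linarith [hs.curvature_small, le_max_right (0 : ℝ)
    (-lambdaMin (hessian (approxTaylor (f x) J T) s))]

/-- One-sided bounds on the derivatives bound the step. -/
theorem StepAccepted.norm_le {f₀ M σ₀ : ℝ} (hp : 2 ≤ p) (hs : StepAccepted θ₁ θ₂ f₀ J T σ s)
    (hσ₀ : 0 < σ₀) (hσ : σ₀ ≤ σ) (hM : 0 ≤ M)
    (hJ : ∀ i, 1 ≤ i → i ≤ p - 1 → -(M * ‖s‖ ^ i) ≤ J i fun _ => s)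
    (hT : -(M * ‖s‖ ^ p) ≤ T fun _ => s) :
    ‖s‖ ≤ 1 + ((p + 1)! : ℝ) * p * M / σ₀ := by
  have hfac : (0 : ℝ) < (p + 1)! := by exact_mod_cast (p + 1).factorial_pos
  rcases le_total ‖s‖ 1 with h1 | h1
  · have : 0 ≤ ((p + 1)! : ℝ) * p * M / σ₀ := by positivity
    linarith
  -- As `‖s‖ ≥ 1`, each of the `p` terms of the polynomial is at least `-M‖s‖^p`, so the
  -- regularization of degree `p + 1` limits `‖s‖`.
  have hterm : ∀ i, 1 ≤ i → i ≤ p → ∀ t : ℝ, -(M * ‖s‖ ^ i) ≤ t →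
      -(M * ‖s‖ ^ p) ≤ 1 / (i ! : ℝ) * t := by
    intro i _ hip t ht
    have hi : (1 : ℝ) ≤ (i ! : ℝ) := by exact_mod_cast i.factorial_pos
    have hc : 1 / (i ! : ℝ) ≤ 1 := by rw [div_le_one (by linarith)]; exact hi
    have hc0 : 0 ≤ 1 / (i ! : ℝ) := by positivity
    have hpow : M * ‖s‖ ^ i ≤ M * ‖s‖ ^ p :=
      mul_le_mul_of_nonneg_left (pow_le_pow_right₀ h1 hip) hM
    have h0 : 0 ≤ M * ‖s‖ ^ i := by positivity
    nlinarith
  have hsum : -(((p - 1 : ℕ) : ℝ) * (M * ‖s‖ ^ p))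
      ≤ ∑ i ∈ Finset.Icc 1 (p - 1), 1 / (i ! : ℝ) * J i fun _ => s := by
    have := Finset.card_nsmul_le_sum (Finset.Icc 1 (p - 1))
      (fun i => 1 / (i ! : ℝ) * J i fun _ => s) (-(M * ‖s‖ ^ p)) (fun i hi => by
        rw [Finset.mem_Icc] at hi
        exact hterm i hi.1 (by omega) _ (hJ i hi.1 hi.2))
    rw [Nat.card_Icc, nsmul_eq_mul, Nat.add_sub_cancel] at this
    linarith
  have htop := hterm p (by omega) le_rfl _ hT
  have hdec := hs.decrease
  simp only [model, approxTaylor_zero _ _ _ (by omega : p ≠ 0), norm_zero,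
    zero_pow (Nat.succ_ne_zero p), mul_zero, add_zero] at hdec
  rw [approxTaylor] at hdec
  rw [Nat.cast_sub (by omega), Nat.cast_one] at hsum
  have hle : σ / ((p + 1)! : ℝ) * ‖s‖ ^ (p + 1) ≤ p * M * ‖s‖ ^ p := by linarith
  have hpos : 0 < ‖s‖ ^ p := by positivity
  rw [pow_succ', ← mul_assoc] at hle
  have h2 := le_of_mul_le_mul_right hle hpos
  rw [div_mul_eq_mul_div, div_le_iff₀ hfac] at h2
  have h3 : σ₀ * ‖s‖ ≤ σ * ‖s‖ := by gcongr
  have h4 : ‖s‖ ≤ ((p + 1)! : ℝ) * p * M / σ₀ := by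
    rw [le_div_iff₀ hσ₀]; linarith
  linarith

end Step

theorem apply_diagonal_ge {r : ℕ} (M : Tensor n r) {c : ℝ} (hr : r ≠ 0)
    (h : ∀ d : E n, ‖d‖ ≤ 1 → -c ≤ M fun _ => d) (s : E n) :
    -(c * ‖s‖ ^ r) ≤ M fun _ => s := by
  rcases eq_or_ne s 0 with rfl | hs
  · rw [norm_zero, zero_pow hr, mul_zero, neg_zero,
      M.map_coord_zero (⟨0, Nat.pos_of_ne_zero hr⟩ : Fin r) rfl]
  have hs' : ‖s‖ ≠ 0 := norm_ne_zero_iff.2 hs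
  have h1 := h (‖s‖⁻¹ • s) (by rw [norm_smul, norm_inv, norm_norm, inv_mul_cancel₀ hs'])
  have h2 : (M fun _ => s) = ‖s‖ ^ r * M fun _ => ‖s‖⁻¹ • s := by
    have := M.map_smul_univ (fun _ => ‖s‖) fun _ => ‖s‖⁻¹ • s
    simpa [smul_smul, hs'] using this
  rw [h2]
  have h3 : 0 ≤ ‖s‖ ^ r := by positivity
  nlinarith

/-- A common one-sided bound on the derivatives of orders `1, …, p`. -/
theorem ProblemAssumptions.iteratedFDeriv_diagonal_ge {f : E n → ℝ} {flow L κhigh κp g b : ℝ}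
    (hp : 2 ≤ p) (hn : 1 ≤ n) (hf : ProblemAssumptions p f flow L κhigh κp) (hκ : 0 ≤ κhigh)
    {x : E n} (hg : ‖gradient f x‖ ≤ g) (hb : -lambdaMin (hessian f x) ≤ b) (hb0 : 0 ≤ b)
    (s : E n) {i : ℕ} (hi : 1 ≤ i) (hip : i ≤ p) :
    -((g + b + κhigh + |κp|) * ‖s‖ ^ i) ≤ iteratedFDeriv ℝ i f x fun _ => s := by
  have hg0 : 0 ≤ g := (norm_nonneg _).trans hg
  have hκp := abs_nonneg κp
  have hmono : ∀ c, c ≤ g + b + κhigh + |κp| → -(c * ‖s‖ ^ i) ≤ iteratedFDeriv ℝ i f x (fun _ => s)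
      → -((g + b + κhigh + |κp|) * ‖s‖ ^ i) ≤ iteratedFDeriv ℝ i f x fun _ => s := by
    intro c hc h
    have : c * ‖s‖ ^ i ≤ (g + b + κhigh + |κp|) * ‖s‖ ^ i := by gcongr
    linarith
  -- For `p = 2` the top order falls under the curvature case, so the bound `κp` is called on only
  -- when `p ≥ 3`.
  rcases (by omega : i = 1 ∨ i = 2 ∨ (3 ≤ i ∧ i ≤ p - 1) ∨ (3 ≤ i ∧ i = p)) with
    rfl | rfl | ⟨h3, h4⟩ | ⟨h3, rfl⟩
  · refine hmono g (by linarith) ?_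
    have h := iteratedFDeriv_one_diagonal_ge f x s
    have : ‖gradient f x‖ * ‖s‖ ≤ g * ‖s‖ := by gcongr
    rw [pow_one]
    linarith
  · refine hmono b (by linarith) ?_
    have h := (lambdaMin_hessian_ge_iff hn (hf.contDiff.of_le (by exact_mod_cast hp)) x (-b)).1
      (by linarith) s
    linarith
  · refine hmono κhigh (by linarith) ?_
    exact apply_diagonal_ge _ (by omega) (fun d hd => hf.intermediate i h3 h4 x d hd) s
  · refine hmono |κp| (by linarith) ?_
    have h := (iteratedFDeriv ℝ i f x).le_opNorm fun _ => s
    rw [Finset.prod_const, Finset.card_univ, Fintype.card_fin] at h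
    have h1 : ‖iteratedFDeriv ℝ i f x‖ * ‖s‖ ^ i ≤ |κp| * ‖s‖ ^ i := by
      gcongr
      exact (hf.top_bounded h3 x).trans (le_abs_self _)
    exact neg_le_of_abs_le (h.trans h1)

/-! ### Sums of windows -/

/-- Shifting by `i` brings in at most `i` lengths of negative index, each equal to `1` by
convention. -/
theorem sum_stepNorm_pow_shift_le (s : ℕ → E n) (q K i : ℕ) :
    ∑ k ∈ Finset.range K, stepNorm s ((k : ℤ) - (i : ℕ)) ^ q
      ≤ i + ∑ k ∈ Finset.range K, ‖s k‖ ^ q := by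
  induction i with
  | zero => simp [stepNorm_natCast]
  | succ i ih =>
    cases K with
    | zero => simp only [Finset.range_zero, Finset.sum_empty, add_zero]; positivity
    | succ K =>
      rw [Finset.sum_range_succ']
      have h0 : stepNorm s (((0 : ℕ) : ℤ) - ((i + 1 : ℕ) : ℤ)) = 1 :=
        if_neg (by push_cast; omega)
      have h1 : ∀ k : ℕ, stepNorm s (((k + 1 : ℕ) : ℤ) - ((i + 1 : ℕ) : ℤ))
          = stepNorm s ((k : ℤ) - (i : ℕ)) := fun k => by congr 1; push_cast; ring
      rw [h0, one_pow, Finset.sum_congr rfl fun k _ => by rw [h1 k]]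
      rw [Finset.sum_range_succ] at ih
      have h2 : 0 ≤ stepNorm s ((K : ℤ) - (i : ℕ)) ^ q := pow_nonneg (stepNorm_nonneg _ _) _
      push_cast
      linarith

theorem window_nonneg (m : ℕ) (s : ℕ → E n) (k : ℕ) : 0 ≤ window m s k :=
  Finset.sum_nonneg fun _ _ => stepNorm_nonneg _ _

/-- The power mean inequality splits each window into its `2 m + 1` shifts, and after exchanging the
sums each shift by `i ≤ 2 m` is handled separately. -/
theorem sum_window_pow_le (m q : ℕ) (s : ℕ → E n) (K : ℕ) :
    ∑ k ∈ Finset.range K, window m s k ^ (q + 1)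
      ≤ (2 * m + 1 : ℝ) ^ (q + 1) * (2 * m + ∑ k ∈ Finset.range K, ‖s k‖ ^ (q + 1)) := by
  have h1 : ∀ k, window m s k ^ (q + 1) ≤ (2 * m + 1 : ℝ) ^ q *
      ∑ i ∈ Finset.range (2 * m + 1), stepNorm s ((k : ℤ) - (i : ℕ)) ^ (q + 1) := by
    intro k
    have := pow_sum_le_card_mul_sum_pow (s := Finset.range (2 * m + 1))
      (f := fun i : ℕ => stepNorm s ((k : ℤ) - (i : ℕ))) (fun i _ => stepNorm_nonneg s _) q
    rw [Finset.card_range] at this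
    push_cast at this
    exact this
  calc ∑ k ∈ Finset.range K, window m s k ^ (q + 1)
      ≤ ∑ k ∈ Finset.range K, (2 * m + 1 : ℝ) ^ q *
          ∑ i ∈ Finset.range (2 * m + 1), stepNorm s ((k : ℤ) - (i : ℕ)) ^ (q + 1) :=
        Finset.sum_le_sum fun k _ => h1 k
    _ = (2 * m + 1 : ℝ) ^ q * ∑ i ∈ Finset.range (2 * m + 1),
          ∑ k ∈ Finset.range K, stepNorm s ((k : ℤ) - (i : ℕ)) ^ (q + 1) := by
        rw [← Finset.mul_sum, Finset.sum_comm]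
    _ ≤ (2 * m + 1 : ℝ) ^ q * ∑ _i ∈ Finset.range (2 * m + 1),
          (2 * m + ∑ k ∈ Finset.range K, ‖s k‖ ^ (q + 1)) := by
        gcongr with i hi
        refine (sum_stepNorm_pow_shift_le s (q + 1) K i).trans ?_
        have : (i : ℝ) ≤ 2 * m := by
          exact_mod_cast Nat.lt_succ_iff.1 (Finset.mem_range.1 hi)
        linarith
    _ = _ := by
        rw [Finset.sum_const, Finset.card_range, nsmul_eq_mul]
        push_cast
        ring

/-! ### Boundedness of the regularization parameter -/

theorem mono_of_update {a σ : ℕ → ℝ} {K : ℕ} (ha : ∀ k, 0 ≤ a k) (h0 : 0 < σ 0)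
    (hσ : ∀ k < K, σ (k + 1) = σ k + σ k * a k) {j k : ℕ} (hjk : j ≤ k) (hk : k ≤ K) :
    0 < σ j ∧ σ j ≤ σ k := by
  have hpos : ∀ k ≤ K, 0 < σ k := by
    intro k
    induction k with
    | zero => exact fun _ => h0
    | succ k ih =>
      intro hk
      have := ih (by omega)
      rw [hσ k (by omega)]
      have := mul_nonneg this.le (ha k)
      linarith
  refine ⟨hpos j (hjk.trans hk), ?_⟩
  induction k, hjk using Nat.le_induction with
  | base => exact le_rfl
  | succ k _ ih =>
    refine (ih (by omega)).trans ?_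
    rw [hσ k (by omega)]
    have := mul_nonneg (hpos k (by omega)).le (ha k)
    linarith

theorem sum_le_of_update {a σ : ℕ → ℝ} {K : ℕ} (ha : ∀ k, 0 ≤ a k) (h0 : 0 < σ 0)
    (hσ : ∀ k < K, σ (k + 1) = σ k + σ k * a k) {k : ℕ} (hk : k ≤ K) :
    σ 0 * ∑ j ∈ Finset.range k, a j ≤ σ k - σ 0 := by
  induction k with
  | zero => simp
  | succ k ih =>
    rw [Finset.sum_range_succ, mul_add, hσ k (by omega)]
    have h1 := ih (by omega)
    have h2 := (mono_of_update ha h0 hσ (Nat.zero_le k) (by omega)).2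
    have h3 := mul_le_mul_of_nonneg_right h2 (ha k)
    linarith

/-- If the growth of `σ` is controlled by the sum of the `a k`, and `a k` is bounded as long as
`σ k` is below a threshold, then `σ` is bounded. -/
theorem update_bounded {a σ : ℕ → ℝ} {K : ℕ} {C₁ C₂ A : ℝ} (ha : ∀ k, 0 ≤ a k) (h0 : 0 < σ 0)
    (hσ : ∀ k < K, σ (k + 1) = σ k + σ k * a k) (hC₂ : 0 ≤ C₂) (hA : 0 ≤ A)
    (hgrowth : σ K - σ 0 ≤ C₁ + C₂ * ∑ k ∈ Finset.range K, a k)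
    (hstep : ∀ k < K, σ k ≤ 2 * C₂ → a k ≤ A) :
    σ K ≤ σ 0 + 2 * C₁ + 2 * (C₂ * (2 * C₂ / σ 0 + A)) := by
  have key : ∀ k ≤ K, C₂ * ∑ j ∈ Finset.range k, a j
      ≤ (σ k - σ 0) / 2 + C₂ * (2 * C₂ / σ 0 + A) := by
    intro k
    induction k with
    | zero => intro _; simp only [Finset.range_zero, Finset.sum_empty, mul_zero, sub_self,
        zero_div, zero_add]; positivity
    | succ k ih =>
      intro hk
      have hm := (mono_of_update ha h0 hσ (Nat.zero_le (k + 1)) hk).2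
      -- Below the threshold, the growth of `σ` bounds the whole past sum and `A` bounds the current
      -- term. Above it, `C₂ * a k` is at most half of the increment `σ k * a k`.
      rcases le_or_gt (σ k) (2 * C₂) with h | h
      · have h1 := sum_le_of_update ha h0 hσ (k := k) (by omega)
        have h2 : ∑ j ∈ Finset.range k, a j ≤ 2 * C₂ / σ 0 := by
          rw [le_div_iff₀ h0]; linarith
        have h3 : ∑ j ∈ Finset.range (k + 1), a j ≤ 2 * C₂ / σ 0 + A := by
          rw [Finset.sum_range_succ]
          linarith [hstep k (by omega) h]
        have h4 := mul_le_mul_of_nonneg_left h3 hC₂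
        linarith
      · have h1 := ih (by omega)
        rw [Finset.sum_range_succ, mul_add, hσ k (by omega)]
        have h2 := mul_le_mul_of_nonneg_right h.le (ha k)
        linarith
  linarith [key K le_rfl]

/-! ### Rates -/

/-- Raise the hypothesis to the power `(p + 1) / q`. This exponent is at most `3`, which allows `D ^
3` for both `q = p` and `q = p - 1`; the extreme case is `p = 2`, `q = 1`. -/
theorem one_le_mul_rpow_of_lt {ε D W : ℝ} {p q : ℕ} (hε : 0 < ε) (hD : 1 ≤ D) (hW : 0 ≤ W)
    (hq : 1 ≤ q) (hpq : p + 1 ≤ 3 * q) (h : ε ≤ D * W ^ q) :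
    1 ≤ D ^ 3 * ε ^ (-((p : ℝ) + 1) / (q : ℝ)) * W ^ (p + 1) := by
  have hq' : (0 : ℝ) < q := by exact_mod_cast hq
  set t : ℝ := ((p : ℝ) + 1) / q with ht
  have ht0 : 0 ≤ t := by positivity
  have ht3 : t ≤ 3 := by rw [ht, div_le_iff₀ hq']; exact_mod_cast hpq
  have h1 : ε ^ t ≤ D ^ 3 * W ^ (p + 1) := by
    calc ε ^ t ≤ (D * W ^ q) ^ t := Real.rpow_le_rpow hε.le h ht0
      _ = D ^ t * (W ^ q) ^ t := Real.mul_rpow (by linarith) (by positivity)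
      _ = D ^ t * W ^ (p + 1) := by
          rw [← Real.rpow_natCast W q, ← Real.rpow_mul hW, ht, mul_div_cancel₀ _ hq'.ne']
          congr 1
          exact_mod_cast Real.rpow_natCast W (p + 1)
      _ ≤ D ^ 3 * W ^ (p + 1) := by
          gcongr
          calc D ^ t ≤ D ^ (3 : ℝ) := Real.rpow_le_rpow_of_exponent_le hD ht3
            _ = D ^ 3 := by exact_mod_cast Real.rpow_natCast D 3
  have h2 : ε ^ (-((p : ℝ) + 1) / (q : ℝ)) = (ε ^ t)⁻¹ := by
    rw [← Real.rpow_neg hε.le, ht, neg_div]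
  have h3 : 0 < ε ^ t := Real.rpow_pos_of_pos hε t
  rw [h2, mul_right_comm, ← div_eq_mul_inv, le_div_iff₀ h3, one_mul]
  exact h1

theorem one_le_rate {p : ℕ} {ε₁ ε₂ : ℝ} (h₁ : 0 < ε₁) (h₁' : ε₁ ≤ 1) : 1 ≤ rate p ε₁ ε₂ := by
  refine le_max_of_le_left (Real.one_le_rpow_of_pos_of_le_one_of_nonpos h₁ h₁' ?_)
  exact div_nonpos_of_nonpos_of_nonneg (by linarith [Nat.cast_nonneg (α := ℝ) p])
    (Nat.cast_nonneg p)

/-! ### Estimates along a run: bounded regularization parameter and iteration count. -/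

section Run

variable {m N : ℕ} {σ₀ θ₁ θ₂ flow L κhigh κp : ℝ} {f : E n → ℝ} {x₀ : E n}
  {x s : ℕ → E n} {σ : ℕ → ℝ} {T : ℕ → Tensor n p}

theorem IsRun.stepAccepted (hrun : IsRun m σ₀ θ₁ θ₂ f x₀ N x s σ T) {k : ℕ} (hk : k < N) :
    StepAccepted θ₁ θ₂ (f (x k)) (derivOracle p f (x k)) (T k) (σ k) (s k) := by
  have h := hrun.step k hk
  rwa [result_runIteration_fst] at h

theorem IsRun.σ_mono (hrun : IsRun m σ₀ θ₁ θ₂ f x₀ N x s σ T) (hσ₀ : 0 < σ₀) {j k : ℕ}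
    (hjk : j ≤ k) (hk : k ≤ N) : 0 < σ j ∧ σ j ≤ σ k :=
  mono_of_update (a := fun k => ‖s k‖ ^ (p + 1)) (fun _ => by positivity)
    (by rw [hrun.σ_zero]; exact hσ₀) hrun.σ_succ hjk hk

theorem derivOracle_eq (f : E n → ℝ) (x : E n) (i : ℕ) (hi : i ≠ 0) (hip : i < p) :
    derivOracle p f x i = iteratedFDeriv ℝ i f x := if_pos ⟨by omega, by omega⟩

/-- The decrease of `f`, and the gradient and curvature after a step, in terms of the window. -/
theorem IsRun.step_bounds (hp : 2 ≤ p) (hm : 1 ≤ m) (hn : 1 ≤ n) (hL : 0 ≤ L) (hσ₀ : 0 < σ₀)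
    (hθ₁ : 0 ≤ θ₁) (hθ₂ : 0 ≤ θ₂)
    (hf : ProblemAssumptions p f flow L κhigh κp)
    (hrun : IsRun m σ₀ θ₁ θ₂ f x₀ N x s σ T) {K : ℕ} (hK : K ≤ N)
    (hpos : ∀ k < K, k % m = 0 → 0 < fdStep m s k) {k : ℕ} (hk : k < K) :
    σ k * ‖s k‖ ^ (p + 1)
        ≤ ((p + 1)! : ℝ) * (f (x k) - f (x (k + 1)) + L * window m s k ^ (p + 1)) ∧
      ‖gradient f (x (k + 1))‖ ≤ (θ₁ * σ k + L) * window m s k ^ p ∧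
      -lambdaMin (hessian f (x (k + 1))) ≤ (θ₂ * σ k + L) * window m s k ^ (p - 1) := by
  have hkN : k < N := by omega
  have hacc := hrun.stepAccepted hkN
  have hsym := hrun.symmetrize_tensor k hkN
  have hJ := derivOracle_eq (p := p) f (x k)
  have hσk := (hrun.σ_mono hσ₀ le_rfl hkN.le).1.le
  have herr := hrun.tensor_error_le_window hp hm hn hL hf hK hpos k hk
  have hE : L * ‖s k‖ + ‖T k - iteratedFDeriv ℝ p f (x k)‖ ≤ L * window m s k := by linarith
  have hsW := norm_le_window m s k
  have hW := window_nonneg m s k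
  have hr := norm_nonneg (s k)
  have hEpow : ∀ j, (L * ‖s k‖ + ‖T k - iteratedFDeriv ℝ p f (x k)‖) * ‖s k‖ ^ j
      ≤ L * window m s k ^ (j + 1) := by
    intro j
    calc _ ≤ L * window m s k * window m s k ^ j := by gcongr
      _ = _ := by ring
  have h1 := hacc.decrease_le hp hf.contDiff hL hf.lipschitz hJ hsym
  have h2 := hacc.norm_gradient_le hp hσk hθ₁ hf.contDiff hL hf.lipschitz hJ hsym
  have h3 := hacc.curvature_le hp hn hσk hθ₂ hf.contDiff hL hf.lipschitz hJ hsym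
  rw [← hrun.x_succ k hkN] at h1 h2 h3
  have e1 := hEpow (p - 1)
  have e2 := hEpow (p - 2)
  rw [Nat.sub_add_cancel (by omega)] at e1
  rw [(by omega : p - 2 + 1 = p - 1)] at e2
  refine ⟨h1.trans (mul_le_mul_of_nonneg_left (by linarith [hEpow p]) (by positivity)), ?_, ?_⟩
  · have : θ₁ * σ k * ‖s k‖ ^ p ≤ θ₁ * σ k * window m s k ^ p := by gcongr
    linarith
  · have : θ₂ * σ k * ‖s k‖ ^ (p - 1) ≤ θ₂ * σ k * window m s k ^ (p - 1) := by gcongr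
    linarith

/-- The growth of the regularization parameter is controlled by the sum of the powers of the
steps. -/
theorem IsRun.σ_growth (hp : 2 ≤ p) (hm : 1 ≤ m) (hn : 1 ≤ n) (hL : 0 ≤ L) (hσ₀ : 0 < σ₀)
    (hθ₁ : 0 ≤ θ₁) (hθ₂ : 0 ≤ θ₂)
    (hf : ProblemAssumptions p f flow L κhigh κp)
    (hrun : IsRun m σ₀ θ₁ θ₂ f x₀ N x s σ T) {K : ℕ} (hK : K ≤ N)
    (hpos : ∀ k < K, k % m = 0 → 0 < fdStep m s k) {Δ : ℝ} (hΔ : f x₀ - flow ≤ Δ) :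
    σ K - σ 0 ≤ ((p + 1)! : ℝ) * (Δ + L * ((2 * m + 1 : ℝ) ^ (p + 1) *
      (2 * m + ∑ k ∈ Finset.range K, ‖s k‖ ^ (p + 1)))) := by
  have h1 : ∀ k ≤ K, σ k - σ 0 ≤ ((p + 1)! : ℝ) * (f (x 0) - f (x k)
      + L * ∑ j ∈ Finset.range k, window m s j ^ (p + 1)) := by
    intro k
    induction k with
    | zero => intro _; simp
    | succ k ih =>
      intro hk
      have h := (hrun.step_bounds hp hm hn hL hσ₀ hθ₁ hθ₂ hf hK hpos (k := k) (by omega)).1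
      have h2 := ih (by omega)
      rw [hrun.σ_succ k (by omega), Finset.sum_range_succ]
      linarith
  refine (h1 K le_rfl).trans ?_
  have h2 := sum_window_pow_le m p s K
  have h3 := hf.lower_bound (x K)
  rw [hrun.x_zero]
  gcongr
  linarith

/-- As long as the regularization parameter is below a threshold, the steps are bounded. -/
theorem IsRun.norm_step_le (hp : 2 ≤ p) (hm : 1 ≤ m) (hn : 1 ≤ n) (hL : 0 ≤ L) (hσ₀ : 0 < σ₀)
    (hθ₁ : 0 ≤ θ₁) (hθ₂ : 0 ≤ θ₂) (hκhigh : 0 ≤ κhigh)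
    (hf : ProblemAssumptions p f flow L κhigh κp)
    (hrun : IsRun m σ₀ θ₁ θ₂ f x₀ N x s σ T) {K : ℕ} (hK : K ≤ N)
    (hpos : ∀ k < K, k % m = 0 → 0 < fdStep m s k) {G B V w : ℝ} (hG : ‖gradient f x₀‖ ≤ G)
    (hB : max 0 (-lambdaMin (hessian f x₀)) ≤ B)
    (hw : w = (2 * m + 1) * (1 + V / σ₀)) {k : ℕ} (hk : k < K) (hσV : σ k ≤ V) :
    ‖s k‖ ≤ 1 + ((p + 1)! : ℝ) * p * ((G + (θ₁ * V + L) * w ^ p)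
      + (B + (θ₂ * V + L) * w ^ (p - 1)) + κhigh + |κp| + L * w) / σ₀ := by
  have hB0 : 0 ≤ B := (le_max_left _ _).trans hB
  have hB1 : -lambdaMin (hessian f x₀) ≤ B := (le_max_right _ _).trans hB
  have hG0 : 0 ≤ G := (norm_nonneg _).trans hG
  have hσk := hrun.σ_mono hσ₀ (Nat.zero_le k) (by omega)
  rw [hrun.σ_zero] at hσk
  have hV : 0 < V := by linarith
  have hρ : 1 ≤ 1 + V / σ₀ := by
    have : 0 ≤ V / σ₀ := by positivity
    linarith
  have hw0 : 0 ≤ w := by rw [hw]; positivity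
  -- A long earlier step would already have pushed `σ` above `V`.
  have hrj : ∀ j < k, ‖s j‖ ≤ 1 + V / σ₀ := by
    intro j hj
    rcases le_total ‖s j‖ 1 with h | h
    · exact h.trans hρ
    have h1 := (hrun.σ_mono hσ₀ (by omega : j + 1 ≤ k) (by omega)).2
    have h2 := hrun.σ_mono hσ₀ (Nat.zero_le j) (by omega)
    rw [hrun.σ_zero] at h2
    rw [hrun.σ_succ j (by omega)] at h1
    have h3 : ‖s j‖ ≤ ‖s j‖ ^ (p + 1) := le_self_pow₀ h (by omega)
    have h4 : σ₀ * ‖s j‖ ^ (p + 1) ≤ σ j * ‖s j‖ ^ (p + 1) :=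
      mul_le_mul_of_nonneg_right h2.2 (by positivity)
    have h5 : ‖s j‖ ^ (p + 1) ≤ V / σ₀ := by
      rw [le_div_iff₀ hσ₀]; linarith
    linarith
  have hst : ∀ j : ℤ, j < k → stepNorm s j ≤ 1 + V / σ₀ := by
    intro j hj
    unfold stepNorm
    split_ifs with h
    · exact hrj _ (by omega)
    · exact hρ
  have hwin : ∀ j < k, window m s j ≤ w := by
    intro j hj
    have h := Finset.sum_le_card_nsmul (Finset.range (2 * m + 1))
      (fun i : ℕ => stepNorm s ((j : ℤ) - (i : ℕ))) _ (fun i _ => hst _ (by omega))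
    rw [Finset.card_range, nsmul_eq_mul] at h
    push_cast at h
    rwa [← hw] at h
  have hwink : window m s k - ‖s k‖ ≤ w := by
    have h := Finset.sum_le_card_nsmul (Finset.range (2 * m))
      (fun i : ℕ => stepNorm s ((k : ℤ) - ((i + 1 : ℕ) : ℤ))) _
      (fun i _ => hst _ (by push_cast; omega))
    rw [Finset.card_range, nsmul_eq_mul] at h
    rw [window, Finset.sum_range_succ', Nat.cast_zero, sub_zero, stepNorm_natCast,
      add_sub_cancel_right]
    push_cast at h ⊢
    rw [hw]
    linarith
  -- Gradient and curvature at `x k` come from the tests on the previous step, or from the initial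
  -- data if `k = 0`.
  have hGk : ‖gradient f (x k)‖ ≤ G + (θ₁ * V + L) * w ^ p ∧
      -lambdaMin (hessian f (x k)) ≤ B + (θ₂ * V + L) * w ^ (p - 1) := by
    have h1 : 0 ≤ (θ₁ * V + L) * w ^ p := by positivity
    have h2 : 0 ≤ (θ₂ * V + L) * w ^ (p - 1) := by positivity
    cases k with
    | zero => rw [hrun.x_zero]; constructor <;> linarith
    | succ j =>
      obtain ⟨-, hg, hb⟩ := hrun.step_bounds hp hm hn hL hσ₀ hθ₁ hθ₂ hf hK hpos
        (k := j) (by omega)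
      have hσj := hrun.σ_mono hσ₀ (Nat.le_succ j) (by omega)
      have hσjV : σ j ≤ V := hσj.2.trans hσV
      have hWj := hwin j (Nat.lt_succ_self j)
      have hWj0 := window_nonneg m s j
      have hσj0 := hσj.1.le
      have e1 : (θ₁ * σ j + L) * window m s j ^ p ≤ (θ₁ * V + L) * w ^ p := by gcongr
      have e2 : (θ₂ * σ j + L) * window m s j ^ (p - 1) ≤ (θ₂ * V + L) * w ^ (p - 1) := by gcongr
      constructor <;> linarith
  have herr := hrun.tensor_error_le_window hp hm hn hL hf hK hpos k hk
  have herr' : ‖T k - iteratedFDeriv ℝ p f (x k)‖ ≤ L * w :=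
    herr.trans (mul_le_mul_of_nonneg_left hwink hL)
  have hlow := fun (i : ℕ) (hi : 1 ≤ i) (hip : i ≤ p) =>
    hf.iteratedFDeriv_diagonal_ge hp hn hκhigh hGk.1 hGk.2 (by positivity) (s k) hi hip
  refine (hrun.stepAccepted (by omega)).norm_le hp hσ₀ hσk.2 (by positivity) ?_ ?_
  · intro i hi hip
    rw [derivOracle_eq f (x k) i (by omega) (by omega)]
    have h := hlow i hi (by omega)
    have : 0 ≤ L * w * ‖s k‖ ^ i := by positivity
    linarith
  · have h := hlow p (by omega) le_rfl
    have h2 := (T k - iteratedFDeriv ℝ p f (x k)).le_opNorm fun _ => s k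
    rw [_root_.sub_apply, Finset.prod_const, Finset.card_univ, Fintype.card_fin] at h2
    have h3 := neg_le_of_abs_le (h2.trans
      (mul_le_mul_of_nonneg_right herr' (by positivity : 0 ≤ ‖s k‖ ^ p)))
    linarith

end Run

/-- The regularization parameter is bounded independently of the dimension and of the run. -/
theorem exists_σ_bound (p m : ℕ) (hp : 2 ≤ p) (hm : 1 ≤ m) (σ₀ θ₁ θ₂ : ℝ) (hσ₀ : 0 < σ₀)
    (hθ₁ : 0 ≤ θ₁) (hθ₂ : 0 ≤ θ₂) (L κhigh κp : ℝ) (hL : 0 ≤ L) (hκhigh : 0 ≤ κhigh)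
    (Δ G B : ℝ) :
    ∃ σmax : ℝ, ∀ n : ℕ, 1 ≤ n → ∀ (f : E n → ℝ) (flow : ℝ) (x₀ : E n),
      ProblemAssumptions p f flow L κhigh κp → f x₀ - flow ≤ Δ → ‖gradient f x₀‖ ≤ G →
      max 0 (-lambdaMin (hessian f x₀)) ≤ B →
      ∀ (N : ℕ) (x s : ℕ → E n) (σ : ℕ → ℝ) (T : ℕ → Tensor n p),
        IsRun m σ₀ θ₁ θ₂ f x₀ N x s σ T →
      ∀ K ≤ N, (∀ k < K, k % m = 0 → 0 < fdStep m s k) → σ K ≤ σmax := by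
  -- `C₂` is the coefficient of `∑ ‖s k‖ ^ (p + 1)` in `IsRun.σ_growth`; `w` and `r` are the bounds
  -- of `IsRun.norm_step_le` at the threshold `V = 2 * C₂`. The sign of `r` is unknown because `G`
  -- and `B` are arbitrary here, hence `|r|`.
  let C₂ : ℝ := ((p + 1)! : ℝ) * (L * (2 * m + 1 : ℝ) ^ (p + 1))
  let w : ℝ := (2 * m + 1) * (1 + 2 * C₂ / σ₀)
  let r : ℝ := 1 + ((p + 1)! : ℝ) * p * ((G + (θ₁ * (2 * C₂) + L) * w ^ p)
      + (B + (θ₂ * (2 * C₂) + L) * w ^ (p - 1)) + κhigh + |κp| + L * w) / σ₀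
  refine ⟨σ₀ + 2 * (((p + 1)! : ℝ) * Δ + C₂ * (2 * m))
    + 2 * (C₂ * (2 * C₂ / σ₀ + |r| ^ (p + 1))), ?_⟩
  intro n hn f flow x₀ hf hΔ hG hB N x s σ T hrun K hK hpos
  have h := update_bounded (a := fun k => ‖s k‖ ^ (p + 1)) (σ := σ) (K := K)
    (C₁ := ((p + 1)! : ℝ) * Δ + C₂ * (2 * m)) (C₂ := C₂) (A := |r| ^ (p + 1))
    (fun _ => by positivity) (by rw [hrun.σ_zero]; exact hσ₀)
    (fun k hk => hrun.σ_succ k (by omega)) (by positivity) (by positivity) ?_ ?_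
  · rwa [hrun.σ_zero] at h
  · refine (hrun.σ_growth hp hm hn hL hσ₀ hθ₁ hθ₂ hf hK hpos hΔ).trans_eq ?_
    simp only [C₂]
    ring
  · intro k hk hσk
    have h := hrun.norm_step_le hp hm hn hL hσ₀ hθ₁ hθ₂ hκhigh hf hK hpos hG hB
      (w := w) rfl hk hσk
    have : ‖s k‖ ≤ |r| := h.trans (le_abs_self _)
    gcongr

/-- If none of the points reached by the first `K` iterations is stationary, then `K` is at most a
multiple of the rate. -/
theorem IsRun.length_le {m N : ℕ} {σ₀ θ₁ θ₂ flow L κhigh κp σmax ε₁ ε₂ : ℝ} {f : E n → ℝ}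
    {x₀ : E n} {x s : ℕ → E n} {σ : ℕ → ℝ} {T : ℕ → Tensor n p}
    (hp : 2 ≤ p) (hm : 1 ≤ m) (hn : 1 ≤ n) (hL : 1 ≤ L) (hσ₀ : 0 < σ₀)
    (hθ₁ : 0 ≤ θ₁) (hθ₂ : 0 ≤ θ₂) (hf : ProblemAssumptions p f flow L κhigh κp)
    (hrun : IsRun m σ₀ θ₁ θ₂ f x₀ N x s σ T) {K : ℕ} (hK : K ≤ N)
    (hpos : ∀ k < K, k % m = 0 → 0 < fdStep m s k) (hσmax : σ K ≤ σmax)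
    (hε₁ : 0 < ε₁) (hε₂ : 0 < ε₂)
    (hstat : ∀ k ≤ K, ¬ SecondOrderStationary f ε₁ ε₂ (x k)) :
    (K : ℝ) ≤ (θ₁ * σmax + θ₂ * σmax + L) ^ 3 *
      ((2 * m + 1 : ℝ) ^ (p + 1) * (2 * m + σmax / σ₀)) * rate p ε₁ ε₂ := by
  set D : ℝ := θ₁ * σmax + θ₂ * σmax + L with hD
  have hσ0K := hrun.σ_mono hσ₀ (Nat.zero_le K) hK
  rw [hrun.σ_zero] at hσ0K
  have hσmax0 : 0 ≤ σmax := by linarith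
  have h1 : 0 ≤ θ₁ * σmax := by positivity
  have h2 : 0 ≤ θ₂ * σmax := by positivity
  have hD1 : 1 ≤ D := by linarith
  have hterm : ∀ k < K, 1 ≤ D ^ 3 * rate p ε₁ ε₂ * window m s k ^ (p + 1) := by
    intro k hk
    obtain ⟨-, hg, hb⟩ := hrun.step_bounds hp hm hn (by linarith) hσ₀ hθ₁ hθ₂ hf hK hpos hk
    have hσk : σ k ≤ σmax := (hrun.σ_mono hσ₀ hk.le hK).2.trans hσmax
    have hW := window_nonneg m s k
    have hd1 : θ₁ * σ k + L ≤ D := by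
      have := mul_le_mul_of_nonneg_left hσk hθ₁
      linarith
    have hd2 : θ₂ * σ k + L ≤ D := by
      have := mul_le_mul_of_nonneg_left hσk hθ₂
      linarith
    -- The tests on step `k` control the point reached by it, so failure of stationarity at `x (k +
    -- 1)` bounds the window at `k` from below.
    have hns := hstat (k + 1) (by omega)
    rw [SecondOrderStationary, not_and_or, not_le, not_le] at hns
    rcases hns with h | h
    · have h3 : ε₁ ≤ D * window m s k ^ p :=
        h.le.trans (hg.trans (mul_le_mul_of_nonneg_right hd1 (by positivity)))
      refine (one_le_mul_rpow_of_lt hε₁ hD1 hW (by omega) (by omega : p + 1 ≤ 3 * p) h3).trans ?_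
      gcongr
      exact le_max_left _ _
    · have h3 : ε₂ ≤ D * window m s k ^ (p - 1) := by
        have := mul_le_mul_of_nonneg_right hd2 (by positivity : 0 ≤ window m s k ^ (p - 1))
        linarith
      refine (one_le_mul_rpow_of_lt (p := p) hε₂ hD1 hW (by omega)
        (by omega : p + 1 ≤ 3 * (p - 1)) h3).trans ?_
      gcongr
      rw [Nat.cast_sub (by omega), Nat.cast_one]
      exact le_max_right _ _
  have hrate : 0 ≤ rate p ε₁ ε₂ := le_max_of_le_left (Real.rpow_nonneg hε₁.le _)
  have hsum := Finset.sum_le_sum fun k (hk : k ∈ Finset.range K) =>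
    hterm k (Finset.mem_range.1 hk)
  rw [Finset.sum_const, Finset.card_range, nsmul_eq_mul, mul_one, ← Finset.mul_sum] at hsum
  have hsteps : ∑ k ∈ Finset.range K, ‖s k‖ ^ (p + 1) ≤ σmax / σ₀ := by
    have h := sum_le_of_update (a := fun k => ‖s k‖ ^ (p + 1)) (σ := σ) (K := K)
      (fun _ => by positivity) (by rw [hrun.σ_zero]; exact hσ₀)
      (fun k hk => hrun.σ_succ k (by omega)) le_rfl
    rw [hrun.σ_zero] at h
    rw [le_div_iff₀ hσ₀]
    linarith
  calc (K : ℝ) ≤ D ^ 3 * rate p ε₁ ε₂ * ∑ k ∈ Finset.range K, window m s k ^ (p + 1) := hsum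
    _ ≤ D ^ 3 * rate p ε₁ ε₂ * ((2 * m + 1 : ℝ) ^ (p + 1) * (2 * m + σmax / σ₀)) := by
        gcongr
        refine (sum_window_pow_le m p s K).trans ?_
        gcongr
    _ = _ := by ring

end ARpFD

/-- The constant `C` depends on the parameters of the algorithm, on the constants of the assumptions
and on upper bounds `Δ, G, B` for the initial gap, gradient norm and negative curvature, but not on
the dimension, the function, the accuracies or the run. -/
theorem mainTheorem2 (p m : ℕ) (hp : 2 ≤ p) (hm : 1 ≤ m)
    (σ₀ θ₁ θ₂ : ℝ) (hσ₀ : 0 < σ₀) (hθ₁ : 1 < θ₁) (hθ₂ : 1 < θ₂)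
    (L κhigh κp : ℝ) (hL : 3 ≤ L) (hκhigh : 0 ≤ κhigh) (Δ G B : ℝ) :
    ∃ C : ℝ, 0 < C ∧
      ∀ (n : ℕ), 1 ≤ n →
      ∀ (f : ARpFD.E n → ℝ) (flow : ℝ) (x₀ : ARpFD.E n),
        ARpFD.ProblemAssumptions p f flow L κhigh κp →
        f x₀ - flow ≤ Δ → ‖gradient f x₀‖ ≤ G →
        max 0 (-ARpFD.lambdaMin (ARpFD.hessian f x₀)) ≤ B →
      ∀ (ε₁ ε₂ : ℝ), 0 < ε₁ → ε₁ ≤ 1 → 0 < ε₂ → ε₂ ≤ 1 →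
      ∀ (N : ℕ) (x s : ℕ → ARpFD.E n) (σ : ℕ → ℝ) (T : ℕ → ARpFD.Tensor n p),
        ARpFD.IsRun m σ₀ θ₁ θ₂ f x₀ N x s σ T →
        C * ARpFD.rate p ε₁ ε₂ ≤ (N : ℝ) →
        ∃ j ≤ N,
          (j : ℝ) ≤ C * ARpFD.rate p ε₁ ε₂ ∧
          (ARpFD.evaluations m f x s T (j + 1) : ℝ) ≤ C * ((n : ℝ) * ARpFD.rate p ε₁ ε₂) ∧
          ARpFD.SecondOrderStationary f ε₁ ε₂ (x j) := by
  obtain ⟨σmax, hσmax⟩ := ARpFD.exists_σ_bound p m hp hm σ₀ θ₁ θ₂ hσ₀ (by linarith) (by linarith)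
    L κhigh κp (by linarith) hκhigh Δ G B
  -- The summand `1` makes `⌊c * R⌋₊` strictly exceed the bound of `IsRun.length_le`, as `R ≥ 1`.
  -- The absolute value is there because nothing is known yet about the sign of `σmax`.
  set c : ℝ := |(θ₁ * σmax + θ₂ * σmax + L) ^ 3 *
      ((2 * m + 1 : ℝ) ^ (p + 1) * (2 * m + σmax / σ₀))| + 1 with hc
  have hc1 : 1 ≤ c := by linarith [abs_nonneg ((θ₁ * σmax + θ₂ * σmax + L) ^ 3 *
      ((2 * m + 1 : ℝ) ^ (p + 1) * (2 * m + σmax / σ₀)))]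
  -- The `j + 1` iterations cost at most `2 n (j + 1) ≤ 2 n (c R + 1) ≤ 4 n c R` evaluations.
  refine ⟨4 * c, by linarith, ?_⟩
  intro n hn f flow x₀ hf hΔ hG hB ε₁ ε₂ hε₁ hε₁' hε₂ hε₂' N x s σ T hrun hN
  have hR : 1 ≤ ARpFD.rate p ε₁ ε₂ := ARpFD.one_le_rate hε₁ hε₁'
  have hcR : 1 ≤ c * ARpFD.rate p ε₁ ε₂ := one_le_mul_of_one_le_of_one_le hc1 hR
  obtain ⟨j, hjK, hj⟩ : ∃ j ≤ ⌊c * ARpFD.rate p ε₁ ε₂⌋₊,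
      ARpFD.SecondOrderStationary f ε₁ ε₂ (x j) := by
    by_contra! hcon
    have hK : ⌊c * ARpFD.rate p ε₁ ε₂⌋₊ ≤ N := by
      have h := Nat.floor_le (by linarith : 0 ≤ c * ARpFD.rate p ε₁ ε₂)
      exact_mod_cast (by linarith : ((⌊c * ARpFD.rate p ε₁ ε₂⌋₊ : ℕ) : ℝ) ≤ N)
    -- The alternative to `h_k > 0` is exact criticality of `x k`, which would make it stationary
    -- for `ε₁`, `ε₂` as well.
    have hpos : ∀ k < ⌊c * ARpFD.rate p ε₁ ε₂⌋₊, k % m = 0 → 0 < ARpFD.fdStep m s k := by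
      intro k hk hkm
      refine (hrun.fdStep_pos k (by omega) hkm).resolve_right fun h => hcon k hk.le ?_
      exact ⟨h.1.trans hε₁.le, by linarith [h.2]⟩
    have hlen := hrun.length_le hp hm hn (by linarith) hσ₀ (by linarith) (by linarith) hf hK hpos
      (hσmax n hn f flow x₀ hf hΔ hG hB N x s σ T hrun _ hK hpos) hε₁ hε₂ hcon
    have hfl := Nat.lt_floor_add_one (c * ARpFD.rate p ε₁ ε₂)
    have habs := mul_le_mul_of_nonneg_right (le_abs_self ((θ₁ * σmax + θ₂ * σmax + L) ^ 3 *
      ((2 * m + 1 : ℝ) ^ (p + 1) * (2 * m + σmax / σ₀)))) (by linarith : 0 ≤ ARpFD.rate p ε₁ ε₂)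
    have hmul := congrArg (· * ARpFD.rate p ε₁ ε₂) hc
    simp only [add_mul, one_mul] at hmul
    linarith
  have hj' : (j : ℝ) ≤ c * ARpFD.rate p ε₁ ε₂ :=
    (Nat.cast_le.2 hjK).trans (Nat.floor_le (by linarith))
  refine ⟨j, ?_, by linarith, ?_, hj⟩
  · exact_mod_cast (by linarith : (j : ℝ) ≤ N)
  · refine (ARpFD.evaluations_le hn m f x s T (j + 1)).trans ?_
    push_cast
    have hn0 : (0 : ℝ) ≤ n := Nat.cast_nonneg n
    nlinarith
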